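/- Let $\sigma\ge 2$ and let $\mathcal T_\sigma$ be the rooted tree in which every vertex has exactly $\sigma$ children (labelled $1,\dots,\sigma$); let $o$ be its root and $p_c=1/\sigma$. Assign to the edges i.i.d. random weights, uniform on $(0,1)$. Let $I_0=\{o\}$ and, given the finite subtree $I_N$, let $I_{N+1}$ be obtained by adjoining to $I_N$ the edge of smallest weight in its boundary; the invasion percolation cluster is $C=\bigcup_{N\ge 0} I_N$, regarded as a set of vertices. For $p\in[0,1]$, consider independent bond percolation on $\mathcal T_\sigma$ with parameter $p$. For a vertex $v$ and a child $y$ of $v$, the percolation cluster emerging from $v$ in the direction of $y$ is the set of descendants $x$ of $v$ (with $x=y$ or $x$ a descendant of $y$) such that all edges on the path from $v$ to $x$ are open (it is empty if the edge $vy$ is closed); its law, as a random set of addresses relative to $y$, does not depend on $v,y$. Let $\zeta(p)$ be the probability that it is finite, and put $\widehat p=p\,\zeta(p)^{\sigma-1}$. **Proposition 2.1.** The following hold. 1. Almost surely there is exactly one infinite self-avoiding path in $C$ that starts at $o$, the backbone $BB$. It is uniformly random: for every $n\ge0$, its vertex at height $n$ is uniformly distributed over the $\sigma^n$ vertices of $\mathcal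 T_\sigma$ at height $n$. If $B_l$ denotes the weight of its $l$-th edge ($l\ge1$), then almost surely, for all $k\ge 0$, the maximum $W_k=\max_{l>k}B_l$ is attained and $p_c<W_k<1$. The backbone is independent of $W=(W_k)_{k\ge0}$. 2. $C$ consists of the backbone and of the branches emerging from it, where the branch emerging from the $k$-th backbone vertex ($k\ge0$, the $0$-th one being $o$) in the direction of a child $y$ of it that is not on the backbone is the set of all $x\in C$ such that $x=y$ or $x$ is a descendant of $y$. Conditionally on $BB$ and $W$, all these branches (over all $k\ge0$ and all directions away from the backbone) are independent, and every branch emerging from the $k$-th backbone vertex is distributed as the percolation cluster with parameter $W_k$ emerging in that direction, conditioned to be finite. 3. Almost surely, for every $k\ge0$, $\widehat W_k<p_c$, and the law of the percolation cluster with parameter $W_k$ emerging in a given direction, conditioned to be finite, equals the law of the (unconditioned, subcritical) percolation cluster with parameter $\widehat W_k$ emerging in that direction. -/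

import Mathlib

open MeasureTheory ProbabilityTheory

namespace InvasionTree

/-- Vertices of the rooted regular tree with forward degree `s`: finite words over `Fin s`.
The root is `[]`, the parent of `i :: v` is `v`, and the height of `v` is its length. -/
abbrev Vertex (s : ℕ) : Type := List (Fin s)

/-- Edges of the tree: `(v, i)` is the edge joining `v` to its `i`-th child `i :: v`. -/
abbrev Edge (s : ℕ) : Type := Vertex s × Fin s

/-- The upper endpoint of an edge. -/
def Edge.top {s : ℕ} (e : Edge s) : Vertex s := e.2 :: e.1

/-- The edges that join a vertex of `S` to a child of it outside `S`. For a set `S` that contains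
the root and all ancestors of its elements this is the edge boundary of the subtree `S`. -/
def boundary {s : ℕ} (S : Set (Vertex s)) : Set (Edge s) :=
  {e | e.1 ∈ S ∧ Edge.top e ∉ S}

/-- The vertex set of the invaded subtree after `n` steps, for edge weights `w`: start from the
root and repeatedly adjoin the boundary edge of smallest weight (edges of equal smallest
weight, which almost surely do not occur, would be adjoined together). -/
def invaded {s : ℕ} (w : Edge s → ℝ) : ℕ → Set (Vertex s)
  | 0 => {[]}
  | n + 1 => invaded w n ∪
      {x | ∃ e ∈ boundary (invaded w n), (∀ f ∈ boundary (invaded w n), w e ≤ w f) ∧ x = Edge.top e}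

/-- The invasion percolation cluster, as a set of vertices. -/
def ipc {s : ℕ} (w : Edge s → ℝ) : Set (Vertex s) := ⋃ n, invaded w n

/-- The vertex at height `k` of the infinite self-avoiding path that rises from the root and
whose `(k + 1)`-st step goes to the child with label `b k`. -/
def rayVertex {s : ℕ} (b : ℕ → Fin s) : ℕ → Vertex s
  | 0 => []
  | k + 1 => b k :: rayVertex b k

/-- The edge from height `j` to height `j + 1` of that path. -/
def rayEdge {s : ℕ} (b : ℕ → Fin s) (j : ℕ) : Edge s := (rayVertex b j, b j)

/-- The part of `C` that emerges from the vertex `v` in the direction of its `i`-th child, each of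
its vertices being described by its address relative to that child. It is empty when the child
(and hence everything above it, if `C` is a subtree) is not in `C`. -/
def branch {s : ℕ} (C : Set (Vertex s)) (v : Vertex s) (i : Fin s) : Set (Vertex s) :=
  {u | u ++ i :: v ∈ C}

/-- The law of the set of open edges in independent bond percolation with parameter `p`. -/
noncomputable def percolation (s : ℕ) (p : unitInterval) : Measure (Set (Edge s)) :=
  setBernoulli (Set.univ : Set (Edge s)) p

/-- The open cluster of the root: the vertices `v` such that every edge on the path from the root
to `v` belongs to the set `η` of open edges. -/
def openCluster {s : ℕ} (η : Set (Edge s)) : Set (Vertex s) :=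
  {v | ∀ e : Edge s, Edge.top e <:+ v → e ∈ η}

/-- The law of the percolation cluster with parameter `p` along the branch in direction `i`. -/
noncomputable def branchLaw {s : ℕ} (p : unitInterval) (i : Fin s) : Measure (Set (Vertex s)) :=
  (percolation s p).map (fun η => branch (openCluster η) [] i)

/-- The law of the percolation cluster with parameter `p` along the branch in direction `i`,
conditioned to be finite. -/
noncomputable def finiteBranchLaw {s : ℕ} (p : unitInterval) (i : Fin s) :
    Measure (Set (Vertex s)) :=
  (cond (percolation s p) {η | (branch (openCluster η) [] i).Finite}).map
    (fun η => branch (openCluster η) [] i)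

instance {s : ℕ} (p : unitInterval) : IsProbabilityMeasure (percolation s p) := by
  unfold percolation; infer_instance

/-- The probability `ζ(p)` that the percolation cluster along the branch in direction `i` is
finite (by symmetry it does not depend on `i`). -/
noncomputable def zeta {s : ℕ} (p : unitInterval) (i : Fin s) : unitInterval :=
  ⟨(percolation s p).real {η | (branch (openCluster η) [] i).Finite},
    measureReal_nonneg, measureReal_le_one⟩

/-- The dual parameter `p ζ(p) ^ (s - 1)`. -/
noncomputable def dual {s : ℕ} (p : unitInterval) (i : Fin s) : unitInterval :=
  p * zeta p i ^ (s - 1)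

end InvasionTree

namespace InvasionTree

/-! Call threshold of a vertex the least `p` for which the edges of weight at most `p` percolate
upwards from it. It is the minimum over the children of the maximum of the edge weight and the
child's threshold. The backbone always steps to the minimising child, and `W` is `forward`, the
sequence of thresholds met along it.

For weights satisfying `Good` the structure is deterministic. Above the `k`-th backbone vertex the
invasion always has a backbone edge of weight at most `forward w k` in its boundary, so it takes
nothing heavier. Conversely, when it takes the heaviest backbone edge above height `k`, whose weight
is `forward w k`, every lighter edge reachable from that vertex is already taken. Hence the branch
in another direction is exactly the cluster at level `forward w k` (`Good.branch_cluster_eq`), and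
it is finite because that direction has a larger threshold.

Almost every weight field is good. The extinction probability `ζ` solves `x = 1 - p + p * x ^ s`,
which has at most one root in `[0, 1)` and none at `p = 1 / s`; so thresholds exceed `1 / s` and
have no atoms, whence no ties. The chance that `forward` is constant for `n` steps is the mean of
`(s * dual) ^ n` at the threshold, which tends to `0` since `dual < 1 / s`.

The laws come from conditioning on the first step (`lintegral_firstStep`): the other directions are
independent and are required only to have a larger threshold, that is, to be finite at the winning
level. Induction along the backbone gives uniformity, independence from `W`, and the conditional law
of the branches. Duality (`dirLaw_duality`) is an induction on the height of a finite set of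
vertices required to lie in the cluster. -/

/-- Edge weights with values in the unit interval. -/
abbrev Field (s : ℕ) : Type := Edge s → unitInterval

/-- The weights on the subtree rooted at `v`, seen as weights on the whole tree. -/
def shift {s : ℕ} (v : Vertex s) (w : Field s) : Field s := fun e => w (e.1 ++ v, e.2)

/-- The least `p` for which a path of length `n` from the root uses only weights at most `p`. -/
noncomputable def level {s : ℕ} : ℕ → Field s → unitInterval
  | 0, _ => 0
  | n + 1, w => ⨅ i, w ([], i) ⊔ level n (shift [i] w)

/-- The least `p` for which the weights at most `p` percolate from the root. -/
noncomputable def threshold {s : ℕ} (w : Field s) : unitInterval := ⨆ n, level n w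

/-- The least `p` for which the weights at most `p` percolate from the root in direction `i`. -/
noncomputable def dirThreshold {s : ℕ} (w : Field s) (i : Fin s) : unitInterval :=
  w ([], i) ⊔ threshold (shift [i] w)

/-- The percolation cluster at level `p` that emerges from the root in direction `i`. -/
def dirCluster {s : ℕ} (w : Field s) (i : Fin s) (p : unitInterval) : Set (Vertex s) :=
  branch (openCluster {e | w e ≤ p}) [] i

/-! ### Thresholds and infinite clusters. -/

section Clusters

variable {s : ℕ}

@[simp] lemma shift_nil (w : Field s) : shift [] w = w := by
  funext e; simp [shift]

lemma shift_shift (u v : Vertex s) (w : Field s) : shift u (shift v w) = shift (u ++ v) w := by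
  funext e; simp [shift]

lemma level_zero (w : Field s) : level 0 w = 0 := rfl

lemma level_succ (n : ℕ) (w : Field s) :
    level (n + 1) w = ⨅ i, w ([], i) ⊔ level n (shift [i] w) := rfl

lemma level_mono (w : Field s) : Monotone fun n => level n w := by
  refine monotone_nat_of_le_succ fun n => ?_
  induction n generalizing w with
  | zero => exact unitInterval.nonneg'
  | succ n ih => exact iInf_mono fun i => sup_le_sup_left (ih _) _

/-- A compactness step: the supremum over heights passes through the infimum over directions because
the levels increase and there are finitely many directions. -/
lemma threshold_eq (w : Field s) : threshold w = ⨅ i, dirThreshold w i := by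
  have h : threshold w = ⨆ n, level (n + 1) w :=
    ((level_mono w).iSup_nat_add 1).symm
  rw [h]
  simp only [level_succ]
  rw [iSup_iInf_of_monotone fun i => ?_]
  · simp only [dirThreshold, threshold, sup_iSup]
  · exact fun m n hmn => sup_le_sup_left (level_mono _ hmn) _

lemma threshold_le_dirThreshold (w : Field s) (i : Fin s) : threshold w ≤ dirThreshold w i := by
  rw [threshold_eq]; exact iInf_le _ i

lemma exists_dirThreshold_eq [NeZero s] (w : Field s) : ∃ i, dirThreshold w i = threshold w := by
  rw [threshold_eq]; exact exists_eq_ciInf_of_finite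

lemma nil_mem_openCluster (η : Set (Edge s)) : [] ∈ openCluster η := by
  intro e he
  simp [Edge.top] at he

lemma openCluster_suffix {η : Set (Edge s)} {u v : Vertex s} (h : u <:+ v)
    (hv : v ∈ openCluster η) : u ∈ openCluster η :=
  fun e he => hv e (he.trans h)

/-- The root is at the right end of a word, so the last letter is the first step. This peels off the
lowest edge and makes recursion on the tree possible. -/
lemma append_singleton_mem_openCluster {η : Set (Edge s)} {u : Vertex s} {i : Fin s} :
    u ++ [i] ∈ openCluster η ↔
      ([], i) ∈ η ∧ u ∈ openCluster {e : Edge s | (e.1 ++ [i], e.2) ∈ η} := by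
  constructor
  · intro h
    refine ⟨h ([], i) (List.suffix_append _ _), fun e he => h (e.1 ++ [i], e.2) ?_⟩
    obtain ⟨x, hx⟩ := he
    exact ⟨x, by rw [← hx]; simp [Edge.top]⟩
  · rintro ⟨h1, h2⟩ ⟨v, j⟩ ⟨x, hx⟩
    simp only [Edge.top] at hx
    rcases List.eq_nil_or_concat v with rfl | ⟨v', k, rfl⟩
    · have := List.append_inj_right' hx rfl
      simp only [List.cons.injEq, and_true] at this
      rwa [this]
    · have hx' : (x ++ j :: v') ++ [k] = u ++ [i] := by simpa using hx
      have h3 := List.append_inj_right' hx' rfl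
      have h4 := List.append_inj_left' hx' rfl
      simp only [List.cons.injEq, and_true] at h3
      subst h3
      simpa using h2 (v', j) ⟨x, h4⟩

lemma mem_dirCluster {w : Field s} {i : Fin s} {p : unitInterval} {u : Vertex s} :
    u ∈ dirCluster w i p ↔
      w ([], i) ≤ p ∧ u ∈ openCluster {e | shift [i] w e ≤ p} := by
  simp only [dirCluster, branch, Set.mem_ofPred_eq]
  exact append_singleton_mem_openCluster

lemma level_le_iff [NeZero s] {n : ℕ} {w : Field s} {p : unitInterval} :
    level n w ≤ p ↔ ∃ v ∈ openCluster {e | w e ≤ p}, v.length = n := by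
  induction n generalizing w with
  | zero =>
    refine ⟨fun _ => ⟨[], nil_mem_openCluster _, rfl⟩, fun _ => ?_⟩
    exact unitInterval.nonneg'
  | succ n ih =>
    have key : level (n + 1) w ≤ p ↔ ∃ i, w ([], i) ≤ p ∧ level n (shift [i] w) ≤ p := by
      rw [level_succ]
      constructor
      · intro h
        obtain ⟨i, hi⟩ := exists_eq_ciInf_of_finite (f := fun i => w ([], i) ⊔ level n (shift [i] w))
        rw [← hi] at h
        exact ⟨i, sup_le_iff.1 h⟩
      · rintro ⟨i, hi⟩
        exact (iInf_le _ i).trans (sup_le_iff.2 hi)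
    rw [key]
    constructor
    · rintro ⟨i, h1, h2⟩
      obtain ⟨v, hv, hn⟩ := ih.1 h2
      exact ⟨v ++ [i], append_singleton_mem_openCluster.2 ⟨h1, hv⟩, by simp [hn]⟩
    · rintro ⟨v, hv, hn⟩
      rcases List.eq_nil_or_concat v with rfl | ⟨u, i, rfl⟩
      · simp at hn
      · rw [List.concat_eq_append, append_singleton_mem_openCluster] at hv
        exact ⟨i, hv.1, ih.2 ⟨u, hv.2, by simpa using hn⟩⟩

/-- With finite branching, a subtree is infinite exactly when it reaches every height. Percolation
thus occurs at the threshold itself, so the inequality is not strict. -/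
lemma infinite_openCluster_iff [NeZero s] {w : Field s} {p : unitInterval} :
    (openCluster {e | w e ≤ p}).Infinite ↔ threshold w ≤ p := by
  rw [threshold, iSup_le_iff]
  constructor
  · intro h n
    by_contra hn
    rw [level_le_iff] at hn
    push Not at hn
    refine h ((List.finite_length_lt (Fin s) n).subset fun v hv => ?_)
    by_contra hlt
    have hle : n ≤ v.length := not_lt.1 hlt
    refine hn (v.drop (v.length - n)) (openCluster_suffix (List.drop_suffix _ _) hv) ?_
    simp; omega
  · intro h hfin
    obtain ⟨N, hN⟩ := (hfin.image List.length).bddAbove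
    obtain ⟨v, hv, hn⟩ := level_le_iff.1 (h (N + 1))
    have := hN ⟨v, hv, rfl⟩
    omega

lemma finite_dirCluster_iff [NeZero s] {w : Field s} {i : Fin s} {p : unitInterval} :
    (dirCluster w i p).Finite ↔ p < dirThreshold w i := by
  rw [← not_iff_not, not_lt, dirThreshold, sup_le_iff, ← infinite_openCluster_iff]
  by_cases h : w ([], i) ≤ p
  · have : dirCluster w i p = openCluster {e | shift [i] w e ≤ p} := by
      ext u; simp [mem_dirCluster, h]
    rw [this]; simp only [h, true_and]; exact Iff.rfl
  · have : dirCluster w i p = ∅ := by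
      ext u; simp [mem_dirCluster, h]
    simp [this, h]

end Clusters

/-! ### The backbone as the path of minimal thresholds. -/

section Backbone

variable {s : ℕ} [NeZero s]

open Classical in
/-- Some element of a nonempty set of directions. -/
noncomputable def pick (S : Set (Fin s)) : Fin s := if h : S.Nonempty then h.some else 0

/-- The direction of the first step of the backbone. -/
noncomputable def firstStep (w : Field s) : Fin s := pick {i | dirThreshold w i = threshold w}

/-- The weights seen from the first vertex of the backbone above the root. -/
noncomputable def advance (w : Field s) : Field s := shift [firstStep w] w

/-- The directions of the steps of the backbone. -/
noncomputable def backbone (w : Field s) (k : ℕ) : Fin s := firstStep (advance^[k] w)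

/-- The percolation threshold of the subtree rooted at the `k`-th backbone vertex. -/
noncomputable def forward (w : Field s) (k : ℕ) : unitInterval := threshold (advance^[k] w)

/-- The cluster at level `forward w k` emerging from the `k`-th backbone vertex
in direction `i`. -/
noncomputable def offBranch (w : Field s) (k : ℕ) (i : Fin s) : Set (Vertex s) :=
  dirCluster (advance^[k] w) i (forward w k)

lemma dirThreshold_firstStep (w : Field s) : dirThreshold w (firstStep w) = threshold w := by
  have h : {i | dirThreshold w i = threshold w}.Nonempty := exists_dirThreshold_eq w
  have := h.some_mem
  rw [firstStep, pick, dif_pos h]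
  exact this

lemma firstStep_eq {w : Field s} {i : Fin s}
    (h : ∀ j, j ≠ i → dirThreshold w i < dirThreshold w j) : firstStep w = i := by
  by_contra hne
  have := h _ hne
  rw [dirThreshold_firstStep] at this
  exact absurd (threshold_le_dirThreshold w i) (not_le.2 this)

lemma advance_iterate (w : Field s) (k : ℕ) :
    advance^[k] w = shift (rayVertex (backbone w) k) w := by
  induction k with
  | zero => simp [rayVertex]
  | succ k ih =>
    rw [Function.iterate_succ_apply', advance]
    conv_lhs => rw [ih, shift_shift, ← ih]
    rfl

/-- The chosen direction realises the threshold. This recursion is the source of the monotonicity of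
`forward` and of its description as a maximum of weights. -/
lemma forward_eq_sup (w : Field s) (k : ℕ) :
    forward w k = w (rayEdge (backbone w) k) ⊔ forward w (k + 1) := by
  rw [forward, ← dirThreshold_firstStep, dirThreshold, forward, Function.iterate_succ_apply']
  congr 1
  rw [advance_iterate]
  simp only [shift, List.nil_append, rayEdge, backbone, advance_iterate]

lemma forward_antitone (w : Field s) : Antitone (forward w) :=
  antitone_nat_of_succ_le fun k => (forward_eq_sup w k).symm ▸ le_sup_right

lemma weight_rayEdge_le (w : Field s) {j k : ℕ} (h : k ≤ j) :
    w (rayEdge (backbone w) j) ≤ forward w k :=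
  le_trans ((forward_eq_sup w j).symm ▸ le_sup_left) (forward_antitone w h)

end Backbone

/-! ### Rays and the position of a vertex relative to a ray. -/

section Rays

variable {s : ℕ}

@[simp] lemma rayVertex_length (b : ℕ → Fin s) (k : ℕ) : (rayVertex b k).length = k := by
  induction k with
  | zero => rfl
  | succ k ih => simp [rayVertex, ih]

lemma rayVertex_suffix (b : ℕ → Fin s) {j k : ℕ} (h : j ≤ k) :
    rayVertex b j <:+ rayVertex b k := by
  induction k, h using Nat.le_induction with
  | base => exact List.suffix_refl _
  | succ k _ ih => exact ih.trans (List.suffix_cons _ _)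

lemma rayVertex_injective (b : ℕ → Fin s) : Function.Injective (rayVertex b) := fun j k h => by
  simpa using congrArg List.length h

lemma rayVertex_congr {b b' : ℕ → Fin s} {k : ℕ} (h : ∀ j < k, b j = b' j) :
    rayVertex b k = rayVertex b' k := by
  induction k with
  | zero => rfl
  | succ k ih =>
    simp [rayVertex, h k (Nat.lt_succ_self k), ih fun j hj => h j (hj.trans (Nat.lt_succ_self k))]

lemma eq_of_suffix_rayVertex {b : ℕ → Fin s} {k j : ℕ} {i : Fin s} {u : Vertex s}
    (hkj : k < j) (h : rayVertex b j <:+ u ++ i :: rayVertex b k) : i = b k := by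
  have h1 : rayVertex b (k + 1) <:+ u ++ i :: rayVertex b k :=
    (rayVertex_suffix b hkj).trans h
  have h2 : i :: rayVertex b k <:+ u ++ i :: rayVertex b k := List.suffix_append _ _
  have h3 := List.suffix_of_suffix_length_le h1 h2 (by simp)
  have h4 := h3.eq_of_length (by simp)
  simp only [rayVertex, List.cons.injEq, and_true] at h4
  exact h4.symm

lemma eq_rayVertex_or_exists (b : ℕ → Fin s) (v : Vertex s) :
    v = rayVertex b v.length ∨
      ∃ (k : ℕ) (i : Fin s) (u : Vertex s), i ≠ b k ∧ v = u ++ i :: rayVertex b k := by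
  induction v with
  | nil => exact Or.inl rfl
  | cons i v ih =>
    rcases ih with h | ⟨k, j, u, hj, rfl⟩
    · by_cases hi : i = b v.length
      · left
        rw [List.length_cons, rayVertex, ← h, ← hi]
      · exact Or.inr ⟨v.length, i, [], hi, by rw [← h]; rfl⟩
    · exact Or.inr ⟨k, j, i :: u, hj, rfl⟩

end Rays

/-! ### Invasion for arbitrary weights. -/

section Invasion

variable {s : ℕ}

lemma exists_mem_boundary {S : Set (Vertex s)} {v x : Vertex s} (hvx : v <:+ x) (hv : v ∈ S)
    (hx : x ∉ S) : ∃ e ∈ boundary S, v <:+ e.1 ∧ Edge.top e <:+ x := by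
  induction x with
  | nil => rw [List.suffix_nil.1 hvx] at hv; exact absurd hv hx
  | cons i x ih =>
    rcases List.suffix_cons_iff.1 hvx with rfl | h
    · exact absurd hv hx
    · by_cases hxS : x ∈ S
      · exact ⟨(x, i), ⟨hxS, hx⟩, h, List.suffix_refl _⟩
      · obtain ⟨e, he, h1, h2⟩ := ih h hxS
        exact ⟨e, he, h1, h2.trans (List.suffix_cons _ _)⟩

lemma finite_boundary {S : Set (Vertex s)} (hS : S.Finite) : (boundary S).Finite :=
  (hS.prod (Set.finite_univ (α := Fin s))).subset fun _ he => ⟨he.1, Set.mem_univ _⟩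

/-- A ray leaves every finite set, and the edge of its first exit above height `k` lies in the
boundary. -/
lemma exists_rayEdge_mem_boundary {S : Set (Vertex s)} (hS : S.Finite) (b : ℕ → Fin s) {k : ℕ}
    (hk : rayVertex b k ∈ S) : ∃ j, k ≤ j ∧ rayEdge b j ∈ boundary S := by
  classical
  have hex : ∃ m, rayVertex b (k + m) ∉ S := by
    by_contra! h
    have hinf : (Set.range fun m => rayVertex b (k + m)).Infinite :=
      Set.infinite_range_of_injective fun m n hmn => by
        simpa using rayVertex_injective b hmn
    exact hinf (hS.subset (Set.range_subset_iff.2 h))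
  obtain ⟨m, hm⟩ : ∃ m, Nat.find hex = m + 1 := by
    refine Nat.exists_eq_succ_of_ne_zero fun h0 => ?_
    have := Nat.find_spec hex
    rw [h0] at this
    exact this hk
  refine ⟨k + m, Nat.le_add_right _ _, ?_, ?_⟩
  · by_contra h
    have := Nat.find_min' hex h
    omega
  · have := Nat.find_spec hex
    rw [hm] at this
    exact this

variable (w : Edge s → ℝ)

lemma invaded_mono : Monotone (invaded w) :=
  monotone_nat_of_le_succ fun _ => Set.subset_union_left

lemma nil_mem_invaded (n : ℕ) : [] ∈ invaded w n :=
  invaded_mono w (Nat.zero_le n) (Set.mem_singleton _)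

lemma invaded_suffix {n : ℕ} {u v : Vertex s} (h : u <:+ v) (hv : v ∈ invaded w n) :
    u ∈ invaded w n := by
  have parent : ∀ n i v, i :: v ∈ invaded w n → v ∈ invaded w n := by
    intro n
    induction n with
    | zero => intro i v h; simp [invaded] at h
    | succ n ih =>
      rintro i v (h | ⟨e, he, -, h⟩)
      · exact Or.inl (ih i v h)
      · simp only [Edge.top, List.cons.injEq] at h
        exact Or.inl (h.2 ▸ he.1)
  induction v with
  | nil => rwa [List.suffix_nil.1 h]
  | cons i v ih =>
    rcases List.suffix_cons_iff.1 h with rfl | h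
    · exact hv
    · exact ih h (parent n i v hv)

lemma ipc_suffix {u v : Vertex s} (h : u <:+ v) (hv : v ∈ ipc w) : u ∈ ipc w := by
  obtain ⟨n, hn⟩ := Set.mem_iUnion.1 hv
  exact Set.mem_iUnion.2 ⟨n, invaded_suffix w h hn⟩

lemma finite_invaded (n : ℕ) : (invaded w n).Finite := by
  induction n with
  | zero => exact Set.finite_singleton _
  | succ n ih =>
    refine ih.union (((finite_boundary ih).image Edge.top).subset ?_)
    rintro x ⟨e, he, -, rfl⟩
    exact ⟨e, he, rfl⟩

/-- Every step adds a vertex: the boundary of a finite invaded set is finite and is met by any ray,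
here the one with constant label `0`. -/
lemma infinite_ipc [NeZero s] : (ipc w).Infinite := by
  intro hfin
  have hcard : ∀ n, n ≤ (invaded w n).ncard := by
    intro n
    induction n with
    | zero => exact Nat.zero_le _
    | succ n ih =>
      obtain ⟨j, -, hj⟩ := exists_rayEdge_mem_boundary (finite_invaded w n) (fun _ => 0) (k := 0)
        (nil_mem_invaded w n)
      obtain ⟨e, he, hmin⟩ := Set.exists_min_image _ w (finite_boundary (finite_invaded w n)) ⟨_, hj⟩
      refine Nat.succ_le_of_lt (ih.trans_lt (Set.ncard_lt_ncard ?_ (finite_invaded w (n + 1))))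
      refine ⟨Set.subset_union_left, fun hsub => he.2 (hsub (Or.inr ⟨e, he, hmin, rfl⟩))⟩
  have h1 := hcard ((ipc w).ncard + 1)
  have h2 : _ ≤ (ipc w).ncard :=
    Set.ncard_le_ncard (Set.subset_iUnion (invaded w) ((ipc w).ncard + 1)) hfin
  omega

end Invasion

/-! ### Deterministic structure of the invasion cluster for good weights. -/

section Structure

variable {s : ℕ} [NeZero s]

/-- Weights for which the invasion percolation cluster has the structure of a backbone with
finite percolation clusters attached to it. -/
structure Good (w : Field s) : Prop where
  weights_injective : Function.Injective w
  dirThreshold_ne : ∀ v i j, i ≠ j → dirThreshold (shift v w) i ≠ dirThreshold (shift v w) j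
  forward_lt : ∀ k, ∃ n, k ≤ n ∧ forward w n < forward w k

/-- The invasion percolation cluster for weights in the unit interval. -/
def cluster (w : Field s) : Set (Vertex s) := ipc fun e => (w e : ℝ)

variable {w : Field s}

/-- If no backbone weight above height `k` attained `forward w k`, then `forward_eq_sup` would keep
`forward` constant from `k` on, against `forward_lt`. -/
lemma Good.exists_weight_eq (hw : Good w) (k : ℕ) :
    ∃ j, k ≤ j ∧ w (rayEdge (backbone w) j) = forward w k := by
  obtain ⟨n, hkn, hn⟩ := hw.forward_lt k
  by_contra! h
  have : ∀ m, k ≤ m → forward w m = forward w k := by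
    intro m hm
    induction m, hm using Nat.le_induction with
    | base => rfl
    | succ m hm ih =>
      have h1 := forward_eq_sup w m
      rcases le_total (w (rayEdge (backbone w) m)) (forward w (m + 1)) with h2 | h2
      · rw [sup_eq_right.2 h2] at h1; rw [← h1, ih]
      · rw [sup_eq_left.2 h2] at h1; exact absurd (h1.symm.trans ih) (h m hm)
  exact absurd (this n hkn) hn.ne

lemma Good.finite_offBranch (hw : Good w) {k : ℕ} {i : Fin s} (hi : i ≠ backbone w k) :
    (offBranch w k i).Finite := by
  rw [offBranch, finite_dirCluster_iff, forward]
  refine lt_of_le_of_ne (threshold_le_dirThreshold _ i) ?_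
  rw [← dirThreshold_firstStep]
  have := hw.dirThreshold_ne (rayVertex (backbone w) k) _ _ hi.symm
  rwa [← advance_iterate] at this

/-- When an edge above the `k`-th backbone vertex is chosen, some backbone edge at height at least
`k` competes with it, and that edge weighs at most `forward w k`. -/
lemma weight_le_of_mem_invaded (w : Field s) {k n : ℕ} {e : Edge s}
    (he : Edge.top e ∈ invaded (fun e => (w e : ℝ)) n) (hk : rayVertex (backbone w) k <:+ e.1) :
    w e ≤ forward w k := by
  induction n with
  | zero => simp [invaded, Edge.top] at he
  | succ n ih =>
    rcases he with he | ⟨e', he', hmin, h⟩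
    · exact ih he
    · obtain rfl : e = e' := by
        simp only [Edge.top, List.cons.injEq] at h
        exact Prod.ext h.2 h.1
      obtain ⟨j, hkj, hj⟩ := exists_rayEdge_mem_boundary (finite_invaded _ n) (backbone w)
        (invaded_suffix _ hk he'.1)
      exact le_trans (Subtype.coe_le_coe.1 (hmin _ hj)) (weight_rayEdge_le w hkj)

lemma mem_offBranch {k : ℕ} {i : Fin s} {u : Vertex s} :
    u ∈ offBranch w k i ↔
      ∀ e : Edge s, Edge.top e <:+ u ++ [i] →
        w (e.1 ++ rayVertex (backbone w) k, e.2) ≤ forward w k := by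
  rw [offBranch, advance_iterate]; exact Iff.rfl

lemma branch_cluster_subset_offBranch (w : Field s) (k : ℕ) (i : Fin s) :
    branch (cluster w) (rayVertex (backbone w) k) i ⊆ offBranch w k i := by
  intro u hu
  obtain ⟨n, hn⟩ := Set.mem_iUnion.1 (show u ++ i :: rayVertex (backbone w) k ∈ cluster w from hu)
  rw [mem_offBranch]
  rintro e ⟨x, hx⟩
  refine weight_le_of_mem_invaded w (n := n) (invaded_suffix _ ⟨x, ?_⟩ hn) (List.suffix_append _ _)
  have : u ++ i :: rayVertex (backbone w) k = (u ++ [i]) ++ rayVertex (backbone w) k := by simp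
  rw [this, ← hx]
  simp [Edge.top]

/-- If the `k`-th backbone vertex were missed, the cluster would lie in finitely many finite
branches and fewer than `k + 1` backbone vertices, although it is infinite. -/
lemma Good.rayVertex_mem_cluster (hw : Good w) (k : ℕ) :
    rayVertex (backbone w) k ∈ cluster w := by
  by_contra hk
  refine infinite_ipc (fun e => (w e : ℝ)) (Set.Finite.subset
    (s := rayVertex (backbone w) '' Set.Iio k ∪ ⋃ j ∈ Set.Iio k, ⋃ i ∈ {i | i ≠ backbone w j},
      (fun u => u ++ i :: rayVertex (backbone w) j) '' offBranch w j i) ?_ ?_)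
  · refine ((Set.finite_Iio k).image _).union ((Set.finite_Iio k).biUnion fun j _ =>
      (Set.toFinite _).biUnion fun i hi => (hw.finite_offBranch hi).image _)
  · intro v hv
    have hlt : ∀ j, rayVertex (backbone w) j <:+ v → j < k := by
      intro j hj
      by_contra hjk
      exact hk (ipc_suffix _ ((rayVertex_suffix _ (not_lt.1 hjk)).trans hj) hv)
    rcases eq_rayVertex_or_exists (backbone w) v with h | ⟨j, i, u, hi, rfl⟩
    · exact Or.inl ⟨v.length, hlt _ (h ▸ List.suffix_refl _), h.symm⟩
    · right
      refine Set.mem_biUnion (hlt j ((List.suffix_cons _ _).trans (List.suffix_append _ _)))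
        (Set.mem_biUnion (show i ∈ {i | i ≠ backbone w j} from hi) ⟨u, ?_, rfl⟩)
      exact branch_cluster_subset_offBranch w j i hv

/-- Consider the step that takes the heaviest backbone edge above height `k`. A vertex of `offBranch
w k i` not yet invaded would leave a boundary edge of weight at most `forward w k` on the way to it.
-/
lemma Good.branch_cluster_eq (hw : Good w) {k : ℕ} {i : Fin s} (hi : i ≠ backbone w k) :
    branch (cluster w) (rayVertex (backbone w) k) i = offBranch w k i := by
  classical
  refine (branch_cluster_subset_offBranch w k i).antisymm fun u hu => ?_
  obtain ⟨l, hkl, hl⟩ := hw.exists_weight_eq k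
  have hex : ∃ n, rayVertex (backbone w) (l + 1) ∈ invaded (fun e => (w e : ℝ)) n :=
    Set.mem_iUnion.1 (hw.rayVertex_mem_cluster (l + 1))
  obtain ⟨n, hn⟩ : ∃ n, Nat.find hex = n + 1 := by
    refine Nat.exists_eq_succ_of_ne_zero fun h0 => ?_
    have := Nat.find_spec hex
    rw [h0] at this
    simp [invaded, rayVertex] at this
  have hmem := Nat.find_spec hex
  rw [hn] at hmem
  rcases hmem with hmem | ⟨e, he, hmin, h⟩
  · have := Nat.find_min' hex hmem
    omega
  obtain rfl : rayEdge (backbone w) l = e := by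
    simp only [Edge.top, List.cons.injEq, rayVertex] at h
    exact Prod.ext h.2 h.1
  change u ++ i :: rayVertex (backbone w) k ∈ ipc _
  refine Set.mem_iUnion.2 ⟨n, ?_⟩
  by_contra hu'
  obtain ⟨f, hf, h1, h2⟩ := exists_mem_boundary (v := rayVertex (backbone w) k)
    ((List.suffix_cons _ _).trans (List.suffix_append _ _))
    (invaded_suffix _ (rayVertex_suffix _ hkl) he.1) hu'
  have hle : w f ≤ forward w k := by
    obtain ⟨x, hx⟩ := h1
    obtain ⟨y, hy⟩ := h2
    have := mem_offBranch.1 hu (x, f.2) ⟨y, ?_⟩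
    · simpa only [hx] using this
    · refine List.append_cancel_right (bs := rayVertex (backbone w) k) ?_
      simpa [Edge.top, ← hx] using hy
  -- Minimality of the chosen edge gives the reverse inequality; with distinct weights `f` is then a
  -- backbone edge, which does not lie in direction `i`.
  have heq : w f = w (rayEdge (backbone w) l) :=
    le_antisymm (hle.trans hl.ge) (Subtype.coe_le_coe.1 (hmin f hf))
  have hfe := hw.weights_injective heq
  rw [hfe] at h2
  exact hi (eq_of_suffix_rayVertex (j := l + 1) (by omega) h2)

/-- A different ray inside the cluster would, from its first deviation on, fill a finite off-branch
with vertices of every height. -/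
lemma Good.ray_mem_cluster_iff (hw : Good w) (b : ℕ → Fin s) :
    (∀ k, rayVertex b k ∈ cluster w) ↔ b = backbone w := by
  classical
  refine ⟨fun h => ?_, fun h => h ▸ hw.rayVertex_mem_cluster⟩
  by_contra hne
  have hex : ∃ k, b k ≠ backbone w k := Function.ne_iff.1 hne
  set k := Nat.find hex
  have hk : b k ≠ backbone w k := Nat.find_spec hex
  have hlt : ∀ j < k, b j = backbone w j := fun j hj => not_not.1 (Nat.find_min hex hj)
  have hv : rayVertex b k = rayVertex (backbone w) k := rayVertex_congr hlt
  have hmem : ∀ m, ∃ u ∈ offBranch w k (b k), u.length = m := by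
    intro m
    obtain ⟨u, hu⟩ := rayVertex_suffix b (show k + 1 ≤ k + 1 + m by omega)
    refine ⟨u, branch_cluster_subset_offBranch w k (b k) ?_, ?_⟩
    · change u ++ b k :: rayVertex (backbone w) k ∈ cluster w
      rw [← hv]
      change u ++ rayVertex b (k + 1) ∈ cluster w
      rw [hu]
      exact h _
    · have := congrArg List.length hu
      simp at this
      omega
  obtain ⟨N, hN⟩ := ((hw.finite_offBranch hk).image List.length).bddAbove
  obtain ⟨u, hu, hl⟩ := hmem (N + 1)
  have := hN ⟨u, hu, rfl⟩
  omega

lemma Good.cluster_eq (hw : Good w) :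
    cluster w = Set.range (rayVertex (backbone w)) ∪
      ⋃ (k : ℕ) (i : Fin s) (_ : i ≠ backbone w k),
        (fun u => u ++ i :: rayVertex (backbone w) k) ''
          branch (cluster w) (rayVertex (backbone w) k) i := by
  apply Set.Subset.antisymm
  · intro v hv
    rcases eq_rayVertex_or_exists (backbone w) v with h | ⟨j, i, u, hi, rfl⟩
    · exact Or.inl ⟨_, h.symm⟩
    · exact Or.inr (Set.mem_iUnion₂.2 ⟨j, i, Set.mem_iUnion.2 ⟨hi, u, hv, rfl⟩⟩)
  · rintro v (⟨k, rfl⟩ | h)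
    · exact hw.rayVertex_mem_cluster k
    · obtain ⟨j, i, h⟩ := Set.mem_iUnion₂.1 h
      obtain ⟨-, u, hu, rfl⟩ := Set.mem_iUnion.1 h
      exact hu

/-- `rayEdge b j` is the `(j + 1)`-st edge of the ray, so `k ≤ j` expresses `l > k` for `l = j + 1`.
-/
lemma Good.isGreatest_forward (hw : Good w) (k : ℕ) :
    IsGreatest {x : ℝ | ∃ j, k ≤ j ∧ x = w (rayEdge (backbone w) j)} (forward w k : ℝ) := by
  constructor
  · obtain ⟨j, hj, h⟩ := hw.exists_weight_eq k
    exact ⟨j, hj, by rw [h]⟩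
  · rintro x ⟨j, hj, rfl⟩
    exact weight_rayEdge_le w hj

end Structure

/-! ### Auxiliary facts on product measures. -/

section ProductMeasure

/-- A product measure over `Option ι` splits off the factor of `none`. -/
lemma map_infinitePi_option {ι X : Type*} [MeasurableSpace X] (ν : Measure X)
    [IsProbabilityMeasure ν] :
    (Measure.infinitePi fun _ : Option ι => ν).map (fun y => (y none, fun i => y (some i))) =
      ν.prod (Measure.infinitePi fun _ : ι => ν) := by
  classical
  have hm : Measurable fun (q : X × (ι → X)) (o : Option ι) => o.elim q.1 q.2 := by
    refine measurable_pi_iff.2 fun o => ?_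
    cases o with
    | none => exact measurable_fst
    | some i => exact (measurable_pi_apply i).comp measurable_snd
  have h : (ν.prod (Measure.infinitePi fun _ : ι => ν)).map
      (fun (q : X × (ι → X)) (o : Option ι) => o.elim q.1 q.2) =
      Measure.infinitePi fun _ : Option ι => ν := by
    refine Measure.eq_infinitePi _ fun S t ht => ?_
    rw [Measure.map_apply hm (MeasurableSet.pi S.countable_toSet fun i _ => ht i)]
    have hpre : (fun (q : X × (ι → X)) (o : Option ι) => o.elim q.1 q.2) ⁻¹' (S : Set _).pi t =
        (if none ∈ S then t none else Set.univ) ×ˢ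
          ((Finset.eraseNone S : Set ι).pi fun i => t (some i)) := by
      ext q
      simp only [Set.mem_preimage, Set.mem_pi, SetLike.mem_coe, Set.mem_prod,
        Finset.mem_eraseNone]
      constructor
      · intro hq
        refine ⟨?_, fun i hi => hq _ hi⟩
        split_ifs with hn
        · exact hq _ hn
        · trivial
      · rintro ⟨h1, h2⟩ (_ | i) ho
        · rw [if_pos ho] at h1
          exact h1
        · exact h2 i ho
    rw [hpre, Measure.prod_prod, Measure.infinitePi_pi _ fun i _ => ht (some i)]
    by_cases hn : none ∈ S
    · rw [if_pos hn]
      conv_rhs => rw [← Finset.insert_eq_of_mem hn, ← Finset.insertNone_eraseNone]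
      rw [Finset.prod_insertNone]
    · rw [if_neg hn, measure_univ, one_mul]
      conv_rhs => rw [← Finset.erase_eq_of_notMem hn, ← Finset.map_some_eraseNone]
      rw [Finset.prod_map]
      rfl
  rw [← h, Measure.map_map (by fun_prop) hm]
  convert Measure.map_id
  funext q
  rfl

lemma lintegral_pi_prod {ι : Type*} [Fintype ι] {X : ι → Type*} [∀ i, MeasurableSpace (X i)]
    (ν : ∀ i, Measure (X i)) [∀ i, IsProbabilityMeasure (ν i)] {f : ∀ i, X i → ENNReal}
    (hf : ∀ i, Measurable (f i)) :
    ∫⁻ x, ∏ i, f i (x i) ∂Measure.pi ν = ∏ i, ∫⁻ y, f i y ∂ν i := by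
  refine (lintegral_prod_eq_prod_lintegral_of_indepFun Finset.univ
    (fun i (x : ∀ i, X i) => f i (x i)) (iIndepFun_pi fun i => (hf i).aemeasurable) fun i =>
      (hf i).comp (measurable_pi_apply i)).trans ?_
  exact Finset.prod_congr rfl fun i _ => (measurePreserving_eval ν i).lintegral_comp (hf i)

end ProductMeasure

/-! ### Independence of the weights in the directions from the root. -/

section OneStep

variable {s : ℕ}

/-- The law of independent uniform edge weights. -/
noncomputable def weightLaw (s : ℕ) : Measure (Field s) :=
  Measure.infinitePi fun _ => (volume : Measure unitInterval)

instance : IsProbabilityMeasure (weightLaw s) := by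
  unfold weightLaw; infer_instance

/-- The law of the weight of an edge together with the weights above it. -/
noncomputable def dirLaw (s : ℕ) : Measure (unitInterval × Field s) :=
  (volume : Measure unitInterval).prod (weightLaw s)

instance : IsProbabilityMeasure (dirLaw s) := by
  unfold dirLaw; infer_instance

/-- The weights in direction `i`: the weight of the first edge and those above it. -/
def dirField (i : Fin s) (w : Field s) : unitInterval × Field s := (w ([], i), shift [i] w)

@[fun_prop] lemma measurable_shift (v : Vertex s) : Measurable (shift (s := s) v) :=
  measurable_pi_iff.2 fun _ => measurable_pi_apply _

@[fun_prop] lemma measurable_dirField (i : Fin s) : Measurable (dirField i) :=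
  (measurable_pi_apply _).prodMk (measurable_shift _)

/-- The weights in the different directions are independent. -/
lemma map_dirField : (weightLaw s).map (fun w i => dirField i w) =
    Measure.pi fun _ : Fin s => dirLaw s := by
  -- Each edge is indexed by its direction from the root, with `none` for the first edge and `some
  -- e` for an edge of the subtree above it.
  let φ : Fin s × Option (Edge s) → Edge s := fun q =>
    q.2.elim ([], q.1) fun e => (e.1 ++ [q.1], e.2)
  have hφ : Function.Injective φ := by
    rintro ⟨i, _ | ⟨u, k⟩⟩ ⟨j, _ | ⟨v, l⟩⟩ h
    · simpa [φ] using h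
    · simp [φ] at h
    · simp [φ] at h
    · simp only [φ, Option.elim, Prod.mk.injEq] at h
      have h1 := List.append_inj' h.1 rfl
      simp only [List.cons.injEq, and_true] at h1
      rw [h1.1, h1.2, h.2]
  have h1 := Measure.map_infinitePi_infinitePi_of_inj (P := fun _ : Edge s =>
    (volume : Measure unitInterval)) hφ
  have h2 := Measure.infinitePi_map_curry (fun (_ : Fin s) (_ : Option (Edge s)) =>
    (volume : Measure unitInterval))
  have h3 : (Measure.pi fun _ : Fin s => Measure.infinitePi fun _ : Option (Edge s) =>
      (volume : Measure unitInterval)).map (fun y i => (y i none, fun e => y i (some e))) =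
      Measure.pi fun _ : Fin s => dirLaw s := by
    have hm : Measurable fun y : Option (Edge s) → unitInterval =>
      (y none, fun e => y (some e)) := by fun_prop
    have := fun i : Fin s => Measure.isProbabilityMeasure_map
      (μ := Measure.infinitePi fun _ : Option (Edge s) => (volume : Measure unitInterval))
      hm.aemeasurable
    rw [Measure.pi_map_pi (fun i => hm.aemeasurable)]
    simp only [map_infinitePi_option]
    rfl
  rw [← h3, ← Measure.infinitePi_eq_pi, ← h2, ← h1, Measure.map_map (by fun_prop) (by fun_prop),
    Measure.map_map (by fun_prop) (by fun_prop)]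
  rfl

lemma measurePreserving_dirFields :
    MeasurePreserving (fun (w : Field s) i => dirField i w) (weightLaw s)
      (Measure.pi fun _ => dirLaw s) := ⟨by fun_prop, map_dirField⟩

lemma measurePreserving_dirField (i : Fin s) :
    MeasurePreserving (dirField i) (weightLaw s) (dirLaw s) :=
  (measurePreserving_eval (fun _ : Fin s => dirLaw s) i).comp measurePreserving_dirFields

lemma measurePreserving_shift (v : Vertex s) :
    MeasurePreserving (shift v) (weightLaw s) (weightLaw s) := by
  refine ⟨measurable_shift v, ?_⟩
  refine Measure.map_infinitePi_infinitePi_of_inj (P := fun _ : Edge s =>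
    (volume : Measure unitInterval)) (f := fun e : Edge s => (e.1 ++ v, e.2)) ?_
  rintro ⟨u, i⟩ ⟨u', j⟩ h
  simpa using h

/-- Integration over the weights, direction `i` being singled out. -/
lemma lintegral_dirFields (i : Fin s) {g : unitInterval × Field s → ENNReal}
    {h : Fin s → unitInterval × Field s → unitInterval × Field s → ENNReal} (hg : Measurable g)
    (hh : ∀ j, Measurable (Function.uncurry (h j))) :
    ∫⁻ w, g (dirField i w) * ∏ j with j ≠ i, h j (dirField i w) (dirField j w) ∂weightLaw s =
      ∫⁻ y, g y * ∏ j with j ≠ i, (∫⁻ z, h j y z ∂dirLaw s) ∂dirLaw s := by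
  -- The directions other than `i` are to be enumerated by `i.succAbove`, which needs the form `m +
  -- 1`.
  obtain ⟨m, rfl⟩ : ∃ m, s = m + 1 := ⟨s - 1, by have := i.pos; omega⟩
  have hprod : ∀ f : Fin (m + 1) → ENNReal, ∏ j with j ≠ i, f j = ∏ k, f (i.succAbove k) := by
    intro f
    have : (Finset.univ.filter fun j => j ≠ i) = Finset.univ.map i.succAboveEmb := by
      ext j
      simp [Fin.exists_succAbove_eq_iff]
    rw [this, Finset.prod_map]
    rfl
  simp only [hprod]
  have hF : Measurable fun q : (unitInterval × Field (m + 1)) ×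
      (Fin m → unitInterval × Field (m + 1)) =>
      g q.1 * ∏ k, h (i.succAbove k) q.1 (q.2 k) :=
    (hg.comp measurable_fst).mul (Finset.measurable_fun_prod _ fun k _ =>
      (hh (i.succAbove k)).comp
        (measurable_fst.prodMk ((measurable_pi_apply k).comp measurable_snd)))
  have hmp := (measurePreserving_piFinSuccAbove
    (fun _ : Fin (m + 1) => dirLaw (m + 1)) i).comp measurePreserving_dirFields
  have h1 := hmp.lintegral_comp hF
  refine Eq.trans ?_ (h1.trans ?_)
  · rfl
  · rw [lintegral_prod _ hF.aemeasurable]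
    refine lintegral_congr fun y => ?_
    have hm : ∀ j, Measurable (h j y) := fun j => (hh j).comp measurable_prodMk_left
    rw [← lintegral_pi_prod _ fun k => hm (i.succAbove k)]
    have hmp : Measurable fun x : Fin m → unitInterval × Field (m + 1) =>
        ∏ k, h (i.succAbove k) y (x k) :=
      Finset.measurable_fun_prod _ fun k _ => (hm _).comp (measurable_pi_apply k)
    exact lintegral_const_mul (g y) hmp

end OneStep

/-! ### Measurability, and percolation coupled through uniform weights. -/

section Measurability

variable {s : ℕ}

@[fun_prop] lemma measurable_level (n : ℕ) : Measurable (level (s := s) n) := by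
  induction n with
  | zero => exact measurable_const
  | succ n ih =>
    exact Measurable.iInf fun i => (measurable_pi_apply _).sup (ih.comp (measurable_shift _))

@[fun_prop] lemma measurable_threshold : Measurable (threshold (s := s)) :=
  Measurable.iSup measurable_level

/-- The threshold in a direction in terms of the weights in that direction. -/
noncomputable def pairThreshold (y : unitInterval × Field s) : unitInterval := y.1 ⊔ threshold y.2

@[fun_prop] lemma measurable_pairThreshold : Measurable (pairThreshold (s := s)) :=
  measurable_fst.sup (measurable_threshold.comp measurable_snd)

@[fun_prop] lemma measurable_dirThreshold (i : Fin s) : Measurable fun w => dirThreshold w i :=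
  measurable_pairThreshold.comp (measurable_dirField i)

/-- Percolation as a level set of the weights. -/
lemma percolation_eq_map (p : unitInterval) :
    percolation s p = (weightLaw s).map fun w => {e | w e ≤ p} := by
  have hm : Measurable fun x : unitInterval => (x ≤ p) := measurableSet_setOfPred.1 measurableSet_Iic
  have hvol : (volume : Measure unitInterval).map (fun x => x ≤ p) =
      unitInterval.toNNReal p • Measure.dirac True +
        unitInterval.toNNReal (unitInterval.symm p) • Measure.dirac False := by
    have h1 : (fun x : unitInterval => x ≤ p) ⁻¹' {True} = Set.Iic p := by ext; simp
    have h2 : (fun x : unitInterval => x ≤ p) ⁻¹' {False} = Set.Ioi p := by ext; simp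
    have e1 : ENNReal.ofReal p = (unitInterval.toNNReal p : ENNReal) :=
      congrArg _ (Real.toNNReal_of_nonneg p.2.1)
    have e2 : ENNReal.ofReal (1 - p) = (unitInterval.toNNReal (unitInterval.symm p) : ENNReal) :=
      congrArg _ (Real.toNNReal_of_nonneg (sub_nonneg.2 p.2.2))
    refine Measure.ext_of_singleton fun a => ?_
    by_cases ha : a
    · obtain rfl : a = True := eq_true ha
      rw [Measure.map_apply hm (measurableSet_singleton _), h1, unitInterval.volume_Iic, e1]
      generalize unitInterval.toNNReal p = a
      generalize unitInterval.toNNReal (unitInterval.symm p) = b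
      simp
    · obtain rfl : a = False := eq_false ha
      rw [Measure.map_apply hm (measurableSet_singleton _), h2, unitInterval.volume_Ioi, e2]
      generalize unitInterval.toNNReal p = a
      generalize unitInterval.toNNReal (unitInterval.symm p) = b
      simp
  rw [percolation, setBernoulli_eq_map]
  have := Measure.infinitePi_map_pi (fun _ : Edge s => (volume : Measure unitInterval))
    (f := fun _ x => x ≤ p) (fun _ => hm)
  simp only [hvol] at this
  simp only [Set.mem_univ]
  rw [← this, Measure.map_map]
  · rfl
  · exact measurable_id
  · exact measurable_pi_iff.2 fun e => hm.comp (measurable_pi_apply e)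

end Measurability

/-! ### The fixed point equation of the extinction probability. -/

section FixedPoint

/-- A bound for the largest fixed point of the generating function. -/
lemma exists_superfixed {s : ℕ} {p : ℝ} (hp1 : p ≤ 1) (hp : 1 < s * p) :
    ∃ a, 0 ≤ a ∧ a < 1 ∧ 1 - p + p * a ^ s ≤ a := by
  have hs : (0 : ℝ) < s := by
    rcases Nat.eq_zero_or_pos s with rfl | h
    · simp at hp; linarith
    · exact_mod_cast h
  -- For `a = 1 - ε` the claim becomes `p * a ^ s ≤ 1 / s`. Bernoulli gives `(1 + ε) ^ s ≥ 1 + s * ε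
  -- = s * p`, and `(1 - ε) ^ s * (1 + ε) ^ s ≤ 1`.
  set ε : ℝ := p - 1 / s with hε
  have hsε : s * ε = s * p - 1 := by rw [hε]; field_simp
  have hε0 : 0 < ε := by
    have : 0 < s * ε := by rw [hsε]; linarith
    exact pos_of_mul_pos_right this hs.le
  have hε1 : ε < 1 := by
    have : 0 < 1 / (s : ℝ) := by positivity
    rw [hε]; linarith
  refine ⟨1 - ε, by linarith, by linarith, ?_⟩
  have h1 : 1 + s * ε ≤ (1 + ε) ^ s := one_add_mul_le_pow (by linarith) s
  have h2 : (1 - ε) ^ s * (1 + s * ε) ≤ 1 := by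
    calc (1 - ε) ^ s * (1 + s * ε) ≤ (1 - ε) ^ s * (1 + ε) ^ s := by
          gcongr
      _ = (1 - ε ^ 2) ^ s := by rw [← mul_pow]; ring
      _ ≤ 1 := pow_le_one₀ (by nlinarith) (by nlinarith)
  rw [hsε] at h2
  have h3 : (1 - ε) ^ s * p ≤ 1 / s := by
    rw [le_div_iff₀ hs]; linarith
  linarith

/-- The equation reads `p * (1 - x ^ s) = 1 - x`; dividing by `1 - x` removes the trivial root `1`.
-/
lemma mul_geom_sum_eq_one {s : ℕ} {p x : ℝ} (hx1 : x < 1) (hx : x = 1 - p + p * x ^ s) :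
    p * ∑ k ∈ Finset.range s, x ^ k = 1 := by
  have h := mul_neg_geom_sum x s
  have h' : (1 - x) * (p * ∑ k ∈ Finset.range s, x ^ k - 1) = 0 := by linear_combination p * h + hx
  rcases mul_eq_zero.1 h' with h0 | h0 <;> linarith

/-- The geometric sum is strictly increasing on `[0, ∞)` because `2 ≤ s`. -/
lemma fixed_unique {s : ℕ} (hs : 2 ≤ s) {p x y : ℝ} (hx0 : 0 ≤ x) (hy0 : 0 ≤ y)
    (hx1 : x < 1) (hy1 : y < 1) (hx : x = 1 - p + p * x ^ s) (hy : y = 1 - p + p * y ^ s) :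
    x = y := by
  have key : ∀ x y : ℝ, 0 ≤ x → x < y →
      ∑ k ∈ Finset.range s, x ^ k < ∑ k ∈ Finset.range s, y ^ k := by
    intro x y hx hxy
    refine Finset.sum_lt_sum (fun k _ => pow_le_pow_left₀ hx hxy.le k) ⟨1, ?_, ?_⟩
    · exact Finset.mem_range.2 (by omega)
    · simpa using hxy
  have h1 := mul_geom_sum_eq_one hx1 hx
  have h2 := mul_geom_sum_eq_one hy1 hy
  have hp : p ≠ 0 := by rintro rfl; simp at h1
  have h3 := mul_left_cancel₀ hp (h1.trans h2.symm)
  rcases lt_trichotomy x y with h | h | h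
  · exact absurd h3 (key _ _ hx0 h).ne
  · exact h
  · exact absurd h3 (key _ _ hy0 h).ne'

/-- The last power is the smallest term of the geometric sum, whose value is `1 / p`. At `x = ζ(p)`
this says that the dual parameter is subcritical. -/
lemma derivative_lt_one {s : ℕ} (hs : 2 ≤ s) {p x : ℝ} (hp : 0 < p) (hx0 : 0 ≤ x) (hx1 : x < 1)
    (hx : x = 1 - p + p * x ^ s) : s * (p * x ^ (s - 1)) < 1 := by
  have h1 := mul_geom_sum_eq_one hx1 hx
  have h2 : ∑ _k ∈ Finset.range s, x ^ (s - 1) < ∑ k ∈ Finset.range s, x ^ k := by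
    refine Finset.sum_lt_sum (fun k hk => pow_le_pow_of_le_one hx0 hx1.le ?_) ⟨0, ?_, ?_⟩
    · have := Finset.mem_range.1 hk; omega
    · simp; omega
    · simpa using pow_lt_one₀ hx0 hx1 (by omega)
  simp only [Finset.sum_const, Finset.card_range, nsmul_eq_mul] at h2
  calc s * (p * x ^ (s - 1)) = p * (s * x ^ (s - 1)) := by ring
    _ < p * ∑ k ∈ Finset.range s, x ^ k := by gcongr
    _ = 1 := h1

lemma eq_one_of_critical {s : ℕ} (hs : 2 ≤ s) {x : ℝ} (hx0 : 0 ≤ x) (hx1 : x ≤ 1)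
    (hx : x = 1 - 1 / s + 1 / s * x ^ s) : x = 1 := by
  by_contra hne
  have hlt := lt_of_le_of_ne hx1 hne
  have h1 := mul_geom_sum_eq_one hlt hx
  have hs0 : (0 : ℝ) < s := by positivity
  have h2 : ∑ k ∈ Finset.range s, x ^ k < ∑ _k ∈ Finset.range s, (1 : ℝ) := by
    refine Finset.sum_lt_sum (fun k _ => pow_le_one₀ hx0 hx1) ⟨1, ?_, ?_⟩
    · exact Finset.mem_range.2 (by omega)
    · simpa using hlt
  simp only [Finset.sum_const, Finset.card_range, nsmul_eq_mul, mul_one] at h2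
  have : (1 : ℝ) / s * ∑ k ∈ Finset.range s, x ^ k < 1 / s * s := by gcongr
  rw [h1, one_div_mul_cancel hs0.ne'] at this
  exact lt_irrefl _ this

end FixedPoint

/-! ### Distribution of the thresholds: criticality and absence of atoms. -/

section Survival

variable {s : ℕ}

lemma measureReal_volume_Iic (p : unitInterval) :
    (volume : Measure unitInterval).real (Set.Iic p) = p := by
  rw [measureReal_def, unitInterval.volume_Iic, ENNReal.toReal_ofReal p.2.1]

lemma measureReal_volume_Iio (p : unitInterval) :
    (volume : Measure unitInterval).real (Set.Iio p) = p := by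
  rw [measureReal_def, unitInterval.volume_Iio, ENNReal.toReal_ofReal p.2.1]

/-- `T` is left free because the recursion is needed both for `threshold` and for each `level n`. -/
lemma weightLaw_real_lt_sup {T : Field s → unitInterval} (hT : Measurable T) (i : Fin s)
    (p : unitInterval) : (weightLaw s).real {w | p < w ([], i) ⊔ T (shift [i] w)} =
      1 - p + p * (weightLaw s).real {w | p < T w} := by
  have h1 : {w : Field s | p < w ([], i) ⊔ T (shift [i] w)} =
      (dirField i ⁻¹' (Set.Iic p ×ˢ {w | p < T w}ᶜ))ᶜ := by
    ext w
    simp only [dirField, Set.mem_ofPred_eq, Set.mem_compl_iff, Set.mem_preimage, Set.mem_prod,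
      Set.mem_Iic, not_lt, not_and_or, not_le, lt_sup_iff]
  have hm : MeasurableSet {w : Field s | p < T w} := measurableSet_lt measurable_const hT
  have hm' := measurableSet_Iic (a := p).prod hm.compl
  rw [h1, probReal_compl_eq_one_sub (measurable_dirField i hm'),
    (measurePreserving_dirField i).measureReal_preimage hm'.nullMeasurableSet, dirLaw,
    measureReal_prod_prod, measureReal_volume_Iic, probReal_compl_eq_one_sub hm]
  ring

/-- The version with `≤` serves to exclude atoms, by comparison with the version with `<`. -/
lemma weightLaw_real_le_sup {T : Field s → unitInterval} (hT : Measurable T) (i : Fin s)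
    (p : unitInterval) : (weightLaw s).real {w | p ≤ w ([], i) ⊔ T (shift [i] w)} =
      1 - p + p * (weightLaw s).real {w | p ≤ T w} := by
  have h1 : {w : Field s | p ≤ w ([], i) ⊔ T (shift [i] w)} =
      (dirField i ⁻¹' (Set.Iio p ×ˢ {w | p ≤ T w}ᶜ))ᶜ := by
    ext w
    simp only [dirField, Set.mem_ofPred_eq, Set.mem_compl_iff, Set.mem_preimage, Set.mem_prod,
      Set.mem_Iio, not_lt, not_and_or, not_le, le_sup_iff]
  have hm : MeasurableSet {w : Field s | p ≤ T w} := measurableSet_le measurable_const hT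
  have hm' := measurableSet_Iio (a := p).prod hm.compl
  rw [h1, probReal_compl_eq_one_sub (measurable_dirField i hm'),
    (measurePreserving_dirField i).measureReal_preimage hm'.nullMeasurableSet, dirLaw,
    measureReal_prod_prod, measureReal_volume_Iio, probReal_compl_eq_one_sub hm]
  ring

lemma weightLaw_real_forall {A : Fin s → Set (unitInterval × Field s)}
    (hA : ∀ i, MeasurableSet (A i)) :
    (weightLaw s).real {w | ∀ i, dirField i w ∈ A i} = ∏ i, (dirLaw s).real (A i) := by
  have h1 : {w : Field s | ∀ i, dirField i w ∈ A i} =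
      (fun w i => dirField i w) ⁻¹' Set.univ.pi A := by ext; simp
  rw [h1, measurePreserving_dirFields.measureReal_preimage
    (MeasurableSet.univ_pi hA).nullMeasurableSet, measureReal_def, Measure.pi_pi]
  simp [measureReal_def]

lemma weightLaw_real_lt_iInf {T : Field s → unitInterval} (hT : Measurable T) (i : Fin s)
    (p : unitInterval) :
    (weightLaw s).real {w | p < ⨅ i, w ([], i) ⊔ T (shift [i] w)} =
      (weightLaw s).real {w | p < w ([], i) ⊔ T (shift [i] w)} ^ s := by
  have := NeZero.of_pos i.pos
  have hA : MeasurableSet {y : unitInterval × Field s | p < y.1 ⊔ T y.2} :=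
    measurableSet_lt measurable_const (measurable_fst.sup (hT.comp measurable_snd))
  have h := weightLaw_real_forall fun _ : Fin s => hA
  rw [Finset.prod_const, Finset.card_univ, Fintype.card_fin,
    ← (measurePreserving_dirField i).measureReal_preimage hA.nullMeasurableSet] at h
  refine Eq.trans (congrArg _ ?_) h
  ext w
  constructor
  · exact fun hw j => show p < w ([], j) ⊔ T (shift [j] w) from
      lt_of_lt_of_le hw (iInf_le (fun i => w ([], i) ⊔ T (shift [i] w)) j)
  · intro hw
    obtain ⟨j, hj⟩ := exists_eq_ciInf_of_finite (f := fun i => w ([], i) ⊔ T (shift [i] w))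
    simp only [Set.mem_ofPred_eq]
    rw [← hj]
    exact hw j

lemma weightLaw_real_le_iInf {T : Field s → unitInterval} (hT : Measurable T) (i : Fin s)
    (p : unitInterval) :
    (weightLaw s).real {w | p ≤ ⨅ i, w ([], i) ⊔ T (shift [i] w)} =
      (weightLaw s).real {w | p ≤ w ([], i) ⊔ T (shift [i] w)} ^ s := by
  have hA : MeasurableSet {y : unitInterval × Field s | p ≤ y.1 ⊔ T y.2} :=
    measurableSet_le measurable_const (measurable_fst.sup (hT.comp measurable_snd))
  have h := weightLaw_real_forall fun _ : Fin s => hA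
  rw [Finset.prod_const, Finset.card_univ, Fintype.card_fin,
    ← (measurePreserving_dirField i).measureReal_preimage hA.nullMeasurableSet] at h
  refine Eq.trans (congrArg _ ?_) h
  ext w
  exact le_iInf_iff (α := unitInterval)

@[fun_prop] lemma measurable_levelSet (p : unitInterval) :
    Measurable fun w : Field s => {e | w e ≤ p} :=
  measurable_pi_iff.2 fun e => measurableSet_setOfPred.1
    (measurableSet_le (measurable_pi_apply e) measurable_const)

@[fun_prop] lemma measurable_branch_openCluster (i : Fin s) :
    Measurable fun η : Set (Edge s) => branch (openCluster η) [] i := by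
  refine measurable_pi_iff.2 fun u => measurableSet_setOfPred.1 ?_
  change MeasurableSet {η : Set (Edge s) | ∀ e : Edge s, Edge.top e <:+ u ++ [i] → e ∈ η}
  simp only [Set.ofPred_forall]
  exact MeasurableSet.iInter fun e => MeasurableSet.iInter fun _ =>
    measurableSet_setOfPred.2 (measurable_set_mem e)

lemma measurableSet_finite_branch (i : Fin s) :
    MeasurableSet {η : Set (Edge s) | (branch (openCluster η) [] i).Finite} :=
  measurable_branch_openCluster i .setOfPred_finite

lemma coe_zeta (p : unitInterval) (i : Fin s) :
    (zeta p i : ℝ) = (weightLaw s).real {w | p < dirThreshold w i} := by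
  have := NeZero.of_pos i.pos
  change (percolation s p).real _ = _
  rw [percolation_eq_map, map_measureReal_apply (measurable_levelSet p)
    (measurableSet_finite_branch i)]
  congr 1
  ext w
  exact finite_dirCluster_iff

lemma weightLaw_real_lt_threshold (p : unitInterval) (i : Fin s) :
    (weightLaw s).real {w | p < threshold w} = (zeta p i : ℝ) ^ s := by
  rw [coe_zeta]
  simp only [threshold_eq]
  exact weightLaw_real_lt_iInf measurable_threshold i p

lemma zeta_fixed (p : unitInterval) (i : Fin s) :
    (zeta p i : ℝ) = 1 - p + p * (zeta p i : ℝ) ^ s := by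
  conv_lhs => rw [coe_zeta]
  rw [← weightLaw_real_lt_threshold]
  exact weightLaw_real_lt_sup measurable_threshold i p

lemma zeta_pos {p : unitInterval} (hp : p < 1) (i : Fin s) : 0 < (zeta p i : ℝ) := by
  rw [zeta_fixed]
  have h1 : (p : ℝ) < 1 := hp
  have h2 : 0 ≤ (p : ℝ) * (zeta p i : ℝ) ^ s := mul_nonneg p.2.1 (pow_nonneg (zeta p i).2.1 _)
  linarith

lemma zeta_lt_one {p : unitInterval} (hp : 1 / (s : ℝ) < p) (i : Fin s) :
    (zeta p i : ℝ) < 1 := by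
  have hs0 : (0 : ℝ) < s := by exact_mod_cast i.pos
  obtain ⟨a, ha0, ha1, ha⟩ := exists_superfixed (s := s) p.2.2
    (by rwa [div_lt_iff₀ hs0, mul_comm] at hp)
  refine lt_of_le_of_lt ?_ ha1
  -- Extinction before height `n` has probability `0` for `n = 0`, and the inequality for `a`
  -- propagates the bound from one generation to the next.
  have hlevel : ∀ n, (weightLaw s).real {w | p < level n w} ≤ a ^ s := by
    intro n
    induction n with
    | zero =>
      have : {w : Field s | p < level 0 w} = ∅ := by
        ext w
        simp [level_zero]
      rw [this, measureReal_empty]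
      positivity
    | succ n ih =>
      simp only [level_succ]
      rw [weightLaw_real_lt_iInf (measurable_level n) i, weightLaw_real_lt_sup (measurable_level n)]
      refine pow_le_pow_left₀ ?_ (le_trans ?_ ha) s
      · have := p.2.2
        have := mul_nonneg p.2.1 (measureReal_nonneg (μ := weightLaw s) (s := {w | p < level n w}))
        linarith
      · have := mul_le_mul_of_nonneg_left ih p.2.1
        linarith
  have hlim : (weightLaw s).real {w | p < threshold w} ≤ a ^ s := by
    have : {w : Field s | p < threshold w} = ⋃ n, {w | p < level n w} := by
      ext w
      simp [threshold, lt_iSup_iff]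
    rw [this]
    have hmono : Monotone fun n => {w : Field s | p < level n w} :=
      fun m n hmn w hw => lt_of_lt_of_le hw (level_mono w hmn)
    exact le_of_tendsto' ((ENNReal.tendsto_toReal (measure_ne_top _ _)).comp
      (tendsto_measure_iUnion_atTop hmono)) hlevel
  rw [weightLaw_real_lt_threshold p i] at hlim
  rw [zeta_fixed]
  have := mul_le_mul_of_nonneg_left hlim p.2.1
  linarith

/-- There is no percolation at `p = 1 / s`, where `1` is the only fixed point in `[0, 1]`. -/
lemma ae_lt_dirThreshold (hs : 2 ≤ s) (i : Fin s) :
    ∀ᵐ w ∂weightLaw s, 1 / (s : ℝ) < dirThreshold w i := by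
  have hs0 : (0 : ℝ) < s := by positivity
  have hs1 : 1 / (s : ℝ) ≤ 1 := by
    rw [div_le_one hs0]
    exact_mod_cast (by omega : 1 ≤ s)
  let p : unitInterval := ⟨1 / s, by positivity, hs1⟩
  have h1 : (zeta p i : ℝ) = 1 := eq_one_of_critical hs (zeta p i).2.1 (zeta p i).2.2
    (zeta_fixed p i)
  rw [coe_zeta] at h1
  have hm : MeasurableSet {w : Field s | p < dirThreshold w i} :=
    measurableSet_lt measurable_const (measurable_dirThreshold i)
  have h2 : (weightLaw s).real {w | p < dirThreshold w i}ᶜ = 0 := by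
    rw [probReal_compl_eq_one_sub hm, h1, sub_self]
  rw [measureReal_eq_zero_iff] at h2
  exact h2

/-- For `p > 1 / s` the probabilities that the threshold is `≥ p` and `> p` solve the same equation
and are both below `1`, so they agree. Smaller values are excluded by `ae_lt_dirThreshold`. -/
lemma weightLaw_dirThreshold_eq (hs : 2 ≤ s) (i : Fin s) (p : unitInterval) :
    weightLaw s {w | dirThreshold w i = p} = 0 := by
  by_cases hp : (p : ℝ) ≤ 1 / s
  · refine measure_mono_null (fun w hw => ?_) (ae_lt_dirThreshold hs i)
    simp only [Set.mem_ofPred_eq] at hw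
    simp [hw] at hp ⊢
    exact hp
  push Not at hp
  set y := (weightLaw s).real {w | p ≤ dirThreshold w i} with hy
  have hyfix : y = 1 - p + p * y ^ s := by
    have h1 : y = _ := weightLaw_real_le_sup measurable_threshold i p
    have h2 : (weightLaw s).real {w | p ≤ threshold w} = y ^ s := by
      simp only [threshold_eq]
      exact weightLaw_real_le_iInf measurable_threshold i p
    rwa [h2] at h1
  have hy1 : y < 1 := by
    -- A threshold at least `p` exceeds any smaller supercritical `q`, so `y ≤ ζ(q) < 1`.
    obtain ⟨q, hq1, hq2⟩ := exists_between hp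
    have hs0 : (0 : ℝ) < s := by positivity
    have hq0 : 0 ≤ q := le_trans (by positivity) hq1.le
    let q' : unitInterval := ⟨q, hq0, hq2.le.trans p.2.2⟩
    refine lt_of_le_of_lt ?_ (zeta_lt_one (p := q') hq1 i)
    rw [coe_zeta]
    exact measureReal_mono fun w hw => lt_of_lt_of_le (show q' < p from hq2) hw
  have hx := fixed_unique hs measureReal_nonneg (zeta p i).2.1 hy1 (zeta_lt_one hp i) hyfix
    (zeta_fixed p i)
  have hdiff : {w : Field s | dirThreshold w i = p} =
      {w | p ≤ dirThreshold w i} \ {w | p < dirThreshold w i} := by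
    ext w
    simp only [Set.mem_ofPred_eq, Set.mem_sdiff, not_lt]
    exact ⟨fun h => ⟨h.ge, h.le⟩, fun h => le_antisymm h.2 h.1⟩
  have hm : MeasurableSet {w : Field s | p < dirThreshold w i} :=
    measurableSet_lt measurable_const (measurable_dirThreshold i)
  rw [← measureReal_eq_zero_iff, hdiff,
    measureReal_sdiff (Set.ofPred_subset_ofPred.2 fun w hw => le_of_lt hw) hm]
  exact sub_eq_zero.2 (hx.trans (coe_zeta p i))

lemma measure_prod_eq_null {X Y : Type*} [MeasurableSpace X] [MeasurableSpace Y]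
    {μ : Measure X} {ν : Measure Y} [SFinite μ] [SFinite ν] {f : X → unitInterval}
    {g : Y → unitInterval} (hf : Measurable f) (hg : Measurable g)
    (h : ∀ x, ν {y | g y = x} = 0) : (μ.prod ν) {q | f q.1 = g q.2} = 0 := by
  have hm : MeasurableSet {q : X × Y | f q.1 = g q.2} :=
    measurableSet_eq_fun (hf.comp measurable_fst) (hg.comp measurable_snd)
  rw [Measure.measure_prod_null hm]
  refine Filter.Eventually.of_forall fun x => ?_
  refine measure_mono_null (fun y hy => ?_) (h (f x))
  exact Eq.symm hy

lemma ae_weights_injective : ∀ᵐ w ∂weightLaw s, Function.Injective w := by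
  have h : ∀ e f : Edge s, e ≠ f → ∀ᵐ w ∂weightLaw s, w e ≠ w f := by
    intro e f hef
    have hmap := Measure.infinitePi_map_eval_prod (P := fun _ : Edge s =>
      (volume : Measure unitInterval)) hef
    have hnull := measure_prod_eq_null (μ := (volume : Measure unitInterval))
      (ν := (volume : Measure unitInterval)) measurable_id measurable_id
      (fun x => by simp)
    have hm : MeasurableSet {q : unitInterval × unitInterval | id q.1 = id q.2} :=
      measurableSet_eq_fun measurable_fst measurable_snd
    rw [← hmap, Measure.map_apply (by fun_prop) hm] at hnull
    rw [ae_iff]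
    simp only [not_not]
    exact hnull
  have h' : ∀ᵐ w ∂weightLaw s, ∀ e f : Edge s, e ≠ f → w e ≠ w f := by
    simpa only [ae_all_iff] using h
  filter_upwards [h'] with w hw e f hef
  by_contra hne
  exact hw e f hne hef

lemma ae_dirThreshold_ne (hs : 2 ≤ s) {i j : Fin s} (hij : i ≠ j) :
    ∀ᵐ w ∂weightLaw s, dirThreshold w i ≠ dirThreshold w j := by
  have hmap := Measure.infinitePi_map_eval_prod (P := fun _ : Fin s => dirLaw s) hij
  have hnull := measure_prod_eq_null (μ := dirLaw s) (ν := dirLaw s) measurable_pairThreshold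
    measurable_pairThreshold (fun x => by
      rw [← (measurePreserving_dirField i).measure_preimage
        (measurableSet_eq_fun measurable_pairThreshold measurable_const).nullMeasurableSet]
      exact weightLaw_dirThreshold_eq hs i x)
  have hm : MeasurableSet {q : (unitInterval × Field s) × (unitInterval × Field s) |
      pairThreshold q.1 = pairThreshold q.2} := measurableSet_eq_fun
    (measurable_pairThreshold.comp measurable_fst) (measurable_pairThreshold.comp measurable_snd)
  rw [← hmap, Measure.infinitePi_eq_pi, ← map_dirField, Measure.map_map (by fun_prop) (by fun_prop),
    Measure.map_apply (by fun_prop) hm] at hnull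
  rw [ae_iff]
  simp only [not_not]
  exact hnull

lemma coe_dual (p : unitInterval) (i : Fin s) :
    (dual p i : ℝ) = p * (zeta p i : ℝ) ^ (s - 1) := rfl

lemma dual_lt (hs : 2 ≤ s) {p : unitInterval} (hp : 1 / (s : ℝ) < p) (i : Fin s) :
    (dual p i : ℝ) < 1 / s := by
  have hs0 : (0 : ℝ) < s := by positivity
  rw [lt_div_iff₀ hs0, mul_comm, coe_dual]
  exact derivative_lt_one hs (lt_trans (by positivity) hp) (zeta p i).2.1 (zeta_lt_one hp i)
    (zeta_fixed p i)

end Survival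

/-! ### A supercritical cluster conditioned to be finite is a subcritical cluster. -/

section Duality

variable {s : ℕ}

/-- The percolation cluster in a direction in terms of the weights in that direction. -/
def pairCluster (y : unitInterval × Field s) (p : unitInterval) : Set (Vertex s) :=
  {u | y.1 ≤ p ∧ u ∈ openCluster {e | y.2 e ≤ p}}

lemma pairCluster_dirField (w : Field s) (i : Fin s) (p : unitInterval) :
    pairCluster (dirField i w) p = dirCluster w i p := by
  ext u
  exact mem_dirCluster.symm

lemma measurable_uncurry_pairCluster :
    Measurable fun q : (unitInterval × Field s) × unitInterval => pairCluster q.1 q.2 := by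
  refine measurable_set_iff.2 fun u => measurableSet_setOfPred.1 ?_
  change MeasurableSet {q : (unitInterval × Field s) × unitInterval |
    q.1.1 ≤ q.2 ∧ ∀ e : Edge s, Edge.top e <:+ u → q.1.2 e ≤ q.2}
  have h : {q : (unitInterval × Field s) × unitInterval |
      q.1.1 ≤ q.2 ∧ ∀ e : Edge s, Edge.top e <:+ u → q.1.2 e ≤ q.2} =
      {q | q.1.1 ≤ q.2} ∩ ⋂ (e : Edge s) (_ : Edge.top e <:+ u), {q | q.1.2 e ≤ q.2} := by
    ext q; simp
  rw [h]
  refine (measurableSet_le (by fun_prop) (by fun_prop)).inter ?_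
  exact MeasurableSet.iInter fun e => MeasurableSet.iInter fun _ =>
    measurableSet_le (by fun_prop) (by fun_prop)

@[fun_prop] lemma measurable_pairCluster (p : unitInterval) :
    Measurable fun y : unitInterval × Field s => pairCluster y p :=
  measurable_uncurry_pairCluster.comp measurable_prodMk_right

lemma finite_pairCluster_iff [NeZero s] {y : unitInterval × Field s} {p : unitInterval} :
    (pairCluster y p).Finite ↔ p < pairThreshold y := by
  rw [← not_iff_not, not_lt, pairThreshold, sup_le_iff, ← infinite_openCluster_iff]
  by_cases h : y.1 ≤ p
  · have : pairCluster y p = openCluster {e | y.2 e ≤ p} := by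
      ext u; simp [pairCluster, h]
    rw [this]; simp only [h, true_and]; exact Iff.rfl
  · have : pairCluster y p = ∅ := by
      ext u; simp [pairCluster, h]
    simp [this, h]

lemma branchLaw_apply (p : unitInterval) (i : Fin s) {A : Set (Set (Vertex s))}
    (hA : MeasurableSet A) : branchLaw p i A = dirLaw s {y | pairCluster y p ∈ A} := by
  have hm : MeasurableSet {y : unitInterval × Field s | pairCluster y p ∈ A} :=
    measurable_pairCluster p hA
  rw [branchLaw, percolation_eq_map, Measure.map_map (measurable_branch_openCluster i)
    (measurable_levelSet p), Measure.map_apply ((measurable_branch_openCluster i).comp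
    (measurable_levelSet p)) hA, ← (measurePreserving_dirField i).measure_preimage
    hm.nullMeasurableSet]
  congr 1
  ext w
  exact iff_of_eq (congrArg (· ∈ A) (pairCluster_dirField w i p).symm)

lemma measurableSet_lt_pairThreshold (p : unitInterval) :
    MeasurableSet {y : unitInterval × Field s | p < pairThreshold y} :=
  measurableSet_lt measurable_const measurable_pairThreshold

lemma coe_zeta_eq_dirLaw (p : unitInterval) (i : Fin s) :
    (zeta p i : ℝ) = (dirLaw s).real {y | p < pairThreshold y} := by
  rw [coe_zeta, ← (measurePreserving_dirField i).measureReal_preimage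
    (measurableSet_lt_pairThreshold p).nullMeasurableSet]
  rfl

lemma finiteBranchLaw_apply (p : unitInterval) (i : Fin s) {A : Set (Set (Vertex s))}
    (hA : MeasurableSet A) : finiteBranchLaw p i A =
      (dirLaw s {y | p < pairThreshold y})⁻¹ *
        dirLaw s {y | p < pairThreshold y ∧ pairCluster y p ∈ A} := by
  have := NeZero.of_pos i.pos
  have key : ∀ B : Set (Set (Vertex s)), MeasurableSet B →
      percolation s p ((fun η => branch (openCluster η) [] i) ⁻¹' B) =
        dirLaw s {y | pairCluster y p ∈ B} := by
    intro B hB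
    rw [← branchLaw_apply p i hB, branchLaw, Measure.map_apply (measurable_branch_openCluster i) hB]
  rw [finiteBranchLaw, Measure.map_apply (measurable_branch_openCluster i) hA,
    cond_apply (measurableSet_finite_branch i)]
  have h1 := key _ MeasurableSet.setOfPred_finite
  have h2 := key _ (MeasurableSet.setOfPred_finite.inter hA)
  have e1 : {y : unitInterval × Field s | p < pairThreshold y} =
      {y | pairCluster y p ∈ {K : Set (Vertex s) | K.Finite}} := by
    ext y; exact finite_pairCluster_iff.symm
  have e2 : {y : unitInterval × Field s | p < pairThreshold y ∧ pairCluster y p ∈ A} =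
      {y | pairCluster y p ∈ {K : Set (Vertex s) | K.Finite} ∩ A} := by
    ext y; exact and_congr_left' finite_pairCluster_iff.symm
  rw [e1, e2, ← h1, ← h2]
  rfl

lemma dirLaw_lt_pairThreshold_ne_zero {p : unitInterval} (hp : p < 1) (i : Fin s) :
    dirLaw s {y | p < pairThreshold y} ≠ 0 := by
  intro h
  have := zeta_pos hp i
  rw [coe_zeta_eq_dirLaw, measureReal_def, h] at this
  simp at this

lemma isProbabilityMeasure_finiteBranchLaw {p : unitInterval} (hp : p < 1) (i : Fin s) :
    IsProbabilityMeasure (finiteBranchLaw p i) := by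
  refine ⟨?_⟩
  rw [finiteBranchLaw_apply p i MeasurableSet.univ]
  simp only [Set.mem_univ, and_true]
  exact ENNReal.inv_mul_cancel (dirLaw_lt_pairThreshold_ne_zero hp i) (measure_ne_top _ _)

lemma nonempty_subset_pairCluster_iff {T : Set (Vertex s)} (hT : T.Nonempty)
    {y : unitInterval × Field s} {p : unitInterval} :
    T ⊆ pairCluster y p ↔
      y.1 ≤ p ∧ ∀ j, {u | u ++ [j] ∈ T} ⊆ pairCluster (dirField j y.2) p := by
  constructor
  · intro h
    refine ⟨(h hT.some_mem).1, fun j u hu => ?_⟩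
    have := (h hu).2
    rwa [append_singleton_mem_openCluster] at this
  · rintro ⟨h1, h2⟩ v hv
    refine ⟨h1, ?_⟩
    rcases List.eq_nil_or_concat v with rfl | ⟨u, j, rfl⟩
    · exact nil_mem_openCluster _
    · rw [List.concat_eq_append] at hv ⊢
      exact append_singleton_mem_openCluster.2 (h2 j hv)

lemma lt_threshold_iff [NeZero s] {w : Field s} {p : unitInterval} :
    p < threshold w ↔ ∀ j, p < dirThreshold w j := by
  refine ⟨fun h j => h.trans_le (threshold_le_dirThreshold w j), fun h => ?_⟩
  rw [← dirThreshold_firstStep]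
  exact h _

lemma measurableSet_subset_pairCluster (T : Set (Vertex s)) (p : unitInterval) :
    MeasurableSet {y : unitInterval × Field s | T ⊆ pairCluster y p} :=
  measurableSet_setOfPred.2 (Measurable.subset measurable_const (measurable_pairCluster p))

lemma dirLaw_subset_pairCluster {T : Set (Vertex s)} (hT : T.Nonempty) (p : unitInterval) :
    (dirLaw s).real {y | T ⊆ pairCluster y p} =
      p * ∏ j, (dirLaw s).real {y | {u | u ++ [j] ∈ T} ⊆ pairCluster y p} := by
  rw [← weightLaw_real_forall fun j => measurableSet_subset_pairCluster _ p]
  have : {y : unitInterval × Field s | T ⊆ pairCluster y p} = Set.Iic p ×ˢ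
      {w | ∀ j, dirField j w ∈ {y | {u | u ++ [j] ∈ T} ⊆ pairCluster y p}} := by
    ext y
    exact nonempty_subset_pairCluster_iff hT
  rw [this, dirLaw, measureReal_prod_prod, measureReal_volume_Iic]

/-- As `T` is nonempty the first edge is open, so finiteness means finiteness in every direction
above it and the event factors over the children. -/
lemma dirLaw_finite_subset_pairCluster [NeZero s] {T : Set (Vertex s)} (hT : T.Nonempty)
    (p : unitInterval) :
    (dirLaw s).real {y | p < pairThreshold y ∧ T ⊆ pairCluster y p} =
      p * ∏ j, (dirLaw s).real
        {y | p < pairThreshold y ∧ {u | u ++ [j] ∈ T} ⊆ pairCluster y p} := by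
  have hm : ∀ j, MeasurableSet {y : unitInterval × Field s |
      p < pairThreshold y ∧ {u | u ++ [j] ∈ T} ⊆ pairCluster y p} := fun j =>
    (measurableSet_lt_pairThreshold p).inter (measurableSet_subset_pairCluster _ p)
  rw [← weightLaw_real_forall hm]
  have : {y : unitInterval × Field s | p < pairThreshold y ∧ T ⊆ pairCluster y p} = Set.Iic p ×ˢ
      {w | ∀ j, dirField j w ∈
        {y | p < pairThreshold y ∧ {u | u ++ [j] ∈ T} ⊆ pairCluster y p}} := by
    ext y
    change (_ ∧ _) ↔ y.1 ≤ p ∧ ∀ j, p < dirThreshold y.2 j ∧ _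
    rw [nonempty_subset_pairCluster_iff hT, forall_and, ← lt_threshold_iff, pairThreshold,
      lt_sup_iff, ← not_le]
    tauto
  rw [this, dirLaw, measureReal_prod_prod, measureReal_volume_Iic]

/-- The `s` children contribute `ζ ^ s` by induction, and `p * ζ ^ s = ζ * (p * ζ ^ (s - 1))` is `ζ`
times the dual parameter. An empty `T` leaves the factor `ζ` alone. -/
lemma dirLaw_duality (p : unitInterval) (i : Fin s) (N : ℕ) {T : Set (Vertex s)}
    (hT : ∀ u ∈ T, u.length < N) :
    (dirLaw s).real {y | p < pairThreshold y ∧ T ⊆ pairCluster y p} =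
      zeta p i * (dirLaw s).real {y | T ⊆ pairCluster y (dual p i)} := by
  have := NeZero.of_pos i.pos
  induction N generalizing T with
  | zero =>
    obtain rfl : T = ∅ := Set.eq_empty_of_forall_notMem fun u hu => Nat.not_lt_zero _ (hT u hu)
    simp [coe_zeta_eq_dirLaw]
  | succ N ih =>
    rcases T.eq_empty_or_nonempty with rfl | hne
    · simp [coe_zeta_eq_dirLaw]
    · rw [dirLaw_finite_subset_pairCluster hne, dirLaw_subset_pairCluster hne]
      have h : ∀ j, ∀ u ∈ {u | u ++ [j] ∈ T}, u.length < N := by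
        intro j u hu
        have := hT _ hu
        simpa using this
      rw [Finset.prod_congr rfl fun j _ => ih (h j), Finset.prod_mul_distrib, Finset.prod_const,
        Finset.card_univ, Fintype.card_fin, coe_dual]
      obtain ⟨m, rfl⟩ : ∃ m, s = m + 1 := ⟨s - 1, by have := i.pos; omega⟩
      rw [Nat.add_sub_cancel, pow_succ]
      ring

/-- The events `T ⊆ K` with `T` finite are closed under intersection, so by this they determine the
law of a random set. -/
lemma generateFrom_subset_cylinders {V : Type*} :
    (Set.instMeasurableSpace : MeasurableSpace (Set V)) =
      MeasurableSpace.generateFrom {S | ∃ T : Set V, T.Finite ∧ S = {K | T ⊆ K}} := by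
  apply le_antisymm
  · have h : @Measurable _ _
        (MeasurableSpace.generateFrom {S | ∃ T : Set V, T.Finite ∧ S = {K | T ⊆ K}})
        Set.instMeasurableSpace (id : Set V → Set V) := by
      refine @measurable_set_iff _ _ (_) _ |>.2 fun a => ?_
      refine @measurableSet_setOfPred _ (_) _ |>.1 ?_
      exact MeasurableSpace.measurableSet_generateFrom
        ⟨{a}, Set.finite_singleton a, by ext; simp⟩
    intro S hS
    exact h hS
  · refine MeasurableSpace.generateFrom_le ?_
    rintro _ ⟨T, hT, rfl⟩
    have : {K : Set V | T ⊆ K} = ⋂ a ∈ T, {K | a ∈ K} := by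
      ext K; simp [Set.subset_def]
    rw [this]
    exact MeasurableSet.biInter hT.countable fun a _ => measurableSet_mem a

/-- A percolation cluster conditioned to be finite is a percolation cluster with the dual
parameter. -/
lemma finiteBranchLaw_eq_branchLaw {p : unitInterval} (hp : p < 1) (i : Fin s) :
    finiteBranchLaw p i = branchLaw (dual p i) i := by
  have := isProbabilityMeasure_finiteBranchLaw hp i
  have : IsProbabilityMeasure (branchLaw (dual p i) i) :=
    Measure.isProbabilityMeasure_map (measurable_branch_openCluster i).aemeasurable
  refine ext_of_generate_finite _ generateFrom_subset_cylinders ?_ ?_ (by simp)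
  · rintro _ ⟨T, hT, rfl⟩ _ ⟨T', hT', rfl⟩ -
    refine ⟨T ∪ T', hT.union hT', ?_⟩
    ext K
    simp [Set.union_subset_iff]
  · rintro _ ⟨T, hT, rfl⟩
    have hmeas : MeasurableSet {K : Set (Vertex s) | T ⊆ K} :=
      measurableSet_setOfPred.2 (Measurable.subset measurable_const measurable_id)
    rw [finiteBranchLaw_apply p i hmeas, branchLaw_apply _ i hmeas]
    obtain ⟨N, hN⟩ := (hT.image List.length).bddAbove
    have h := dirLaw_duality p i (N + 1) (T := T)
      fun u hu => Nat.lt_succ_of_le (hN ⟨u, hu, rfl⟩)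
    rw [coe_zeta_eq_dirLaw] at h
    simp only [measureReal_def] at h
    rw [← ENNReal.toReal_mul, ENNReal.toReal_eq_toReal_iff' (measure_ne_top _ _)
      (ENNReal.mul_ne_top (measure_ne_top _ _) (measure_ne_top _ _))] at h
    simp only [Set.mem_ofPred_eq]
    rw [h, ← mul_assoc, ENNReal.inv_mul_cancel (dirLaw_lt_pairThreshold_ne_zero hp i)
      (measure_ne_top _ _), one_mul]

end Duality

/-! ### Conditioning on the first step of the backbone. -/

section Decomposition

variable {s : ℕ}

lemma measurable_prod_ne {X : Type*} [MeasurableSpace X] {g : Fin s → X → ENNReal}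
    {c : X → Fin s} (hg : ∀ j, Measurable (g j)) (hc : Measurable c) :
    Measurable fun x => ∏ j with j ≠ c x, g j x := by
  simp only [Finset.prod_filter]
  refine Finset.measurable_fun_prod _ fun j _ => Measurable.ite ?_ (hg j) measurable_const
  exact (measurableSet_eq_fun measurable_const hc).compl

/-- The probability that the percolation cluster at level `p` in a direction is finite and
belongs to `A`. -/
noncomputable def finiteMass (p : unitInterval) (A : Set (Set (Vertex s))) : ENNReal :=
  dirLaw s {z | p < pairThreshold z ∧ pairCluster z p ∈ A}

lemma measurableSet_finiteMass {A : Set (Set (Vertex s))} (hA : MeasurableSet A) :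
    MeasurableSet {q : unitInterval × (unitInterval × Field s) |
      q.1 < pairThreshold q.2 ∧ pairCluster q.2 q.1 ∈ A} :=
  (measurableSet_lt measurable_fst (measurable_pairThreshold.comp measurable_snd)).inter
    ((measurable_uncurry_pairCluster.comp measurable_swap) hA)

lemma measurable_finiteMass {A : Set (Set (Vertex s))} (hA : MeasurableSet A) :
    Measurable fun p => finiteMass (s := s) p A :=
  measurable_measure_prodMk_left (measurableSet_finiteMass hA)

lemma finiteMass_univ (p : unitInterval) :
    finiteMass (s := s) p Set.univ = dirLaw s {z | p < pairThreshold z} := by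
  simp [finiteMass]

/-- This is the definition of conditioning; when finiteness has probability zero both sides vanish,
so `p < 1` is not required. -/
lemma finiteMass_eq (p : unitInterval) (i : Fin s) {A : Set (Set (Vertex s))}
    (hA : MeasurableSet A) :
    finiteMass p A = finiteBranchLaw p i A * finiteMass (s := s) p Set.univ := by
  rw [finiteBranchLaw_apply p i hA, finiteMass_univ]
  rcases eq_or_ne (dirLaw s {z | p < pairThreshold z}) 0 with h | h
  · rw [h, mul_zero]
    exact measure_mono_null (fun z hz => hz.1) h
  · rw [mul_right_comm, ENNReal.inv_mul_cancel h (measure_ne_top _ _), one_mul]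
    rfl

lemma measurable_finiteBranchLaw (i : Fin s) {A : Set (Set (Vertex s))} (hA : MeasurableSet A) :
    Measurable fun p => finiteBranchLaw p i A := by
  have h : (fun p => finiteBranchLaw p i A) =
      fun p => (finiteMass (s := s) p Set.univ)⁻¹ * finiteMass p A := by
    funext p
    rw [finiteBranchLaw_apply p i hA, finiteMass_univ]
    rfl
  rw [h]
  exact (measurable_finiteMass MeasurableSet.univ).inv.mul (measurable_finiteMass hA)

lemma lintegral_dirLaw {G : unitInterval × Field s → ENNReal} (hG : Measurable G) :
    ∫⁻ y, G y ∂dirLaw s = ∫⁻ u, ∫⁻ t, G (u, t) ∂weightLaw s :=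
  lintegral_prod _ hG.aemeasurable

variable [NeZero s]

@[fun_prop] lemma measurable_firstStep : Measurable (firstStep (s := s)) := by
  have h : Measurable fun w : Field s => {i | dirThreshold w i = threshold w} :=
    measurable_set_iff.2 fun i => measurableSet_setOfPred.1
      (measurableSet_eq_fun (measurable_dirThreshold i) measurable_threshold)
  exact (Measurable.of_discrete (f := pick (s := s))).comp h

@[fun_prop] lemma measurable_advance : Measurable (advance (s := s)) := by
  have h : Measurable fun q : Fin s × Field s => shift [q.1] q.2 :=
    measurable_from_prod_countable_right fun i => measurable_shift [i]
  exact h.comp (measurable_firstStep.prodMk measurable_id)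

@[fun_prop] lemma measurable_backbone : Measurable (backbone (s := s)) :=
  measurable_pi_iff.2 fun k => measurable_firstStep.comp (measurable_advance.iterate k)

@[fun_prop] lemma measurable_forward : Measurable (forward (s := s)) :=
  measurable_pi_iff.2 fun k => measurable_threshold.comp (measurable_advance.iterate k)

@[fun_prop] lemma measurable_offBranch (k : ℕ) (i : Fin s) :
    Measurable fun w : Field s => offBranch w k i := by
  have h : (fun w : Field s => offBranch w k i) =
      fun w => pairCluster (dirField i (advance^[k] w)) (forward w k) := by
    funext w
    rw [pairCluster_dirField, offBranch]
  rw [h]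
  exact measurable_uncurry_pairCluster.comp
    (((measurable_dirField i).comp (measurable_advance.iterate k)).prodMk
      ((measurable_pi_apply k).comp measurable_forward))

/-- Up to ties, `i` is the first step when all other directions have larger thresholds. The level of
their clusters is then the threshold in direction `i`, so given the weights there the conditions on
the others are independent. -/
lemma lintegral_firstStep_eq (hs : 2 ≤ s) (i : Fin s) {G : unitInterval × Field s → ENNReal}
    (hG : Measurable G) {A : Fin s → Set (Set (Vertex s))} (hA : ∀ j, MeasurableSet (A j)) :
    ∫⁻ w, (if firstStep w = i then G (dirField i w) *
        ∏ j with j ≠ i, (A j).indicator 1 (dirCluster w j (threshold w)) else 0) ∂weightLaw s =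
      ∫⁻ y, G y * ∏ j with j ≠ i, finiteMass (pairThreshold y) (A j) ∂dirLaw s := by
  let M : Fin s → Set ((unitInterval × Field s) × (unitInterval × Field s)) := fun j =>
    {q | pairThreshold q.1 < pairThreshold q.2 ∧ pairCluster q.2 (pairThreshold q.1) ∈ A j}
  have hM : ∀ j, MeasurableSet (M j) := fun j =>
    (measurable_pairThreshold.prodMap measurable_id) (measurableSet_finiteMass (hA j))
  have hkey := lintegral_dirFields i hG (h := fun j y z => (M j).indicator 1 (y, z))
    fun j => measurable_one.indicator (hM j)
  have hmass : ∀ j y, ∫⁻ z, (M j).indicator 1 (y, z) ∂dirLaw s =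
      finiteMass (pairThreshold y) (A j) := by
    intro j y
    exact lintegral_indicator_one (measurable_prodMk_left (hM j))
  simp only [hmass] at hkey
  rw [← hkey]
  have hne : ∀ᵐ w ∂weightLaw s, ∀ j, i ≠ j → dirThreshold w i ≠ dirThreshold w j := by
    rw [ae_all_iff]
    intro j
    by_cases hij : i = j
    · simp [hij]
    · simpa [hij] using ae_dirThreshold_ne hs hij
  refine lintegral_congr_ae ?_
  filter_upwards [hne] with w hw
  by_cases hi : firstStep w = i
  · rw [if_pos hi]
    congr 1
    refine Finset.prod_congr rfl fun j hj => ?_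
    have hj' : j ≠ i := (Finset.mem_filter.1 hj).2
    have hthr : threshold w = dirThreshold w i := by rw [← dirThreshold_firstStep, hi]
    have hlt : dirThreshold w i < dirThreshold w j := by
      refine lt_of_le_of_ne ?_ (hw j hj'.symm)
      rw [← hthr]
      exact threshold_le_dirThreshold w j
    have hiff : (dirField i w, dirField j w) ∈ M j ↔ dirCluster w j (threshold w) ∈ A j := by
      rw [hthr, ← pairCluster_dirField]
      exact ⟨fun h => h.2, fun h => ⟨hlt, h⟩⟩
    by_cases hmem : dirCluster w j (threshold w) ∈ A j
    · rw [Set.indicator_of_mem hmem, Set.indicator_of_mem (hiff.2 hmem)]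
      rfl
    · rw [Set.indicator_of_notMem hmem, Set.indicator_of_notMem (mt hiff.1 hmem)]
  · rw [if_neg hi]
    have : ∃ j, j ≠ i ∧ ¬ dirThreshold w i < dirThreshold w j := by
      by_contra! h
      exact hi (firstStep_eq h)
    obtain ⟨j, hj, hlt⟩ := this
    symm
    refine mul_eq_zero_of_right _ (Finset.prod_eq_zero
      (Finset.mem_filter.2 ⟨Finset.mem_univ j, hj⟩) (Set.indicator_of_notMem ?_ _))
    exact fun h => hlt h.1

/-- Integration over the weights by conditioning on the first step of the backbone. -/
lemma lintegral_firstStep (hs : 2 ≤ s) {G : Fin s → unitInterval × Field s → ENNReal}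
    (hG : ∀ i, Measurable (G i)) {A : Fin s → Set (Set (Vertex s))}
    (hA : ∀ j, MeasurableSet (A j)) :
    ∫⁻ w, G (firstStep w) (dirField (firstStep w) w) *
        ∏ j with j ≠ firstStep w, (A j).indicator 1 (offBranch w 0 j) ∂weightLaw s =
      ∑ i, ∫⁻ y, G i y * ∏ j with j ≠ i, finiteMass (pairThreshold y) (A j) ∂dirLaw s := by
  rw [Finset.sum_congr rfl fun i _ => (lintegral_firstStep_eq hs i (hG i) hA).symm,
    ← lintegral_finsetSum]
  · refine lintegral_congr fun w => ?_
    rw [Finset.sum_ite_eq, if_pos (Finset.mem_univ _)]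
    rfl
  · intro i _
    refine Measurable.ite (measurableSet_eq_fun measurable_firstStep measurable_const) ?_
      measurable_const
    exact ((hG i).comp (measurable_dirField i)).mul (Finset.measurable_fun_prod _ fun j _ =>
      (measurable_one.indicator (hA j)).comp (measurable_offBranch 0 j))

lemma lintegral_firstStep' (hs : 2 ≤ s) {G : Fin s → unitInterval × Field s → ENNReal}
    (hG : ∀ i, Measurable (G i)) :
    ∫⁻ w, G (firstStep w) (dirField (firstStep w) w) ∂weightLaw s =
      ∑ i, ∫⁻ y, G i y * finiteMass (s := s) (pairThreshold y) Set.univ ^ (s - 1) ∂dirLaw s := by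
  have h := lintegral_firstStep hs hG (A := fun _ => Set.univ) fun _ => MeasurableSet.univ
  have hcard : ∀ i : Fin s, (Finset.univ.filter fun j => j ≠ i).card = s - 1 := by
    intro i
    rw [Finset.filter_ne' Finset.univ i, Finset.card_erase_of_mem (Finset.mem_univ i),
      Finset.card_univ, Fintype.card_fin]
  simpa [hcard] using h

end Decomposition

/-! ### Induction along the backbone. -/

section Markov

variable {s : ℕ} [NeZero s]

/-- The sequence `a, f 0, f 1, …`. -/
def consSeq {α : Type*} (a : α) (f : ℕ → α) : ℕ → α
  | 0 => a
  | n + 1 => f n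

lemma measurable_consSeq {α : Type*} [MeasurableSpace α] :
    Measurable fun q : α × (ℕ → α) => consSeq q.1 q.2 := by
  refine measurable_pi_iff.2 fun n => ?_
  cases n with
  | zero => exact measurable_fst
  | succ n => exact (measurable_pi_apply n).comp measurable_snd

lemma backbone_eq_consSeq (w : Field s) :
    backbone w = consSeq (firstStep w) (backbone (dirField (firstStep w) w).2) := by
  funext n; cases n <;> rfl

lemma forward_eq_consSeq (w : Field s) :
    forward w = consSeq (pairThreshold (dirField (firstStep w) w))
      (forward (dirField (firstStep w) w).2) := by
  funext n
  cases n with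
  | zero => exact (dirThreshold_firstStep w).symm
  | succ n => rfl

/-- The backbone is uniform given the forward thresholds. -/
lemma lintegral_backbone_prefix (hs : 2 ≤ s) (n : ℕ) (b : ℕ → Fin s)
    {f : (ℕ → unitInterval) → ENNReal} (hf : Measurable f) :
    ∫⁻ w, {w : Field s | ∀ k < n, backbone w k = b k}.indicator 1 w * f (forward w) ∂weightLaw s =
      (s : ENNReal)⁻¹ ^ n * ∫⁻ w, f (forward w) ∂weightLaw s := by
  have hs0 : (s : ENNReal) ≠ 0 := by simp; omega
  induction n generalizing b f with
  | zero => simp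
  | succ n ih =>
    have hmeas : ∀ (n : ℕ) (b : ℕ → Fin s),
        MeasurableSet {w : Field s | ∀ k < n, backbone w k = b k} := by
      intro n b
      have : {w : Field s | ∀ k < n, backbone w k = b k} =
          ⋂ (k : ℕ) (_ : k < n), {w | backbone w k = b k} := by ext; simp
      rw [this]
      exact MeasurableSet.iInter fun k => MeasurableSet.iInter fun _ =>
        measurableSet_eq_fun (by fun_prop) measurable_const
    let b' : ℕ → Fin s := fun k => b (k + 1)
    let g : unitInterval × Field s → ENNReal := fun y =>
      f (consSeq (pairThreshold y) (forward y.2))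
    have hg : Measurable g := hf.comp (measurable_consSeq.comp
      (measurable_pairThreshold.prodMk (measurable_forward.comp measurable_snd)))
    have hmass := measurable_finiteMass (s := s) MeasurableSet.univ
    -- `J` does not depend on the direction: without constraint the first step yields `s` copies of
    -- it, and prescribing the first step keeps one.
    let J : ENNReal := ∫⁻ y, g y * finiteMass (s := s) (pairThreshold y) Set.univ ^ (s - 1) ∂dirLaw s
    have h1 : ∫⁻ w, f (forward w) ∂weightLaw s = s * J := by
      have := lintegral_firstStep' hs (G := fun _ => g) fun _ => hg
      rw [Finset.sum_const, Finset.card_univ, Fintype.card_fin, nsmul_eq_mul] at this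
      rw [← this]
      exact lintegral_congr fun w => congrArg f (forward_eq_consSeq w)
    have h2 : ∫⁻ w, {w : Field s | ∀ k < n + 1, backbone w k = b k}.indicator 1 w *
        f (forward w) ∂weightLaw s = (s : ENNReal)⁻¹ ^ n * J := by
      let H : Fin s → unitInterval × Field s → ENNReal := fun i y =>
        if i = b 0 then {w : Field s | ∀ k < n, backbone w k = b' k}.indicator 1 y.2 * g y else 0
      have hH0 : Measurable fun y : unitInterval × Field s =>
          {w : Field s | ∀ k < n, backbone w k = b' k}.indicator 1 y.2 * g y :=
        ((measurable_one.indicator (hmeas n b')).comp measurable_snd).mul hg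
      have hH : ∀ i, Measurable (H i) := by
        intro i
        by_cases hi : i = b 0
        · simp only [H, if_pos hi]
          exact hH0
        · simp only [H, if_neg hi]
          exact measurable_const
      have h3 := lintegral_firstStep' hs hH
      have h4 : ∀ i, ∫⁻ y, H i y * finiteMass (s := s) (pairThreshold y) Set.univ ^ (s - 1)
          ∂dirLaw s = if i = b 0 then (s : ENNReal)⁻¹ ^ n * J else 0 := by
        intro i
        by_cases hi : i = b 0
        · simp only [H, if_pos hi]
          rw [lintegral_dirLaw (G := fun y => {w : Field s | ∀ k < n, backbone w k = b' k}.indicator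
            1 y.2 * g y * finiteMass (s := s) (pairThreshold y) Set.univ ^ (s - 1))
            (hH0.mul ((hmass.comp measurable_pairThreshold).pow_const _))]
          have hgm : Measurable fun y : unitInterval × Field s =>
              g y * finiteMass (s := s) (pairThreshold y) Set.univ ^ (s - 1) :=
            hg.mul ((hmass.comp measurable_pairThreshold).pow_const _)
          have h5 : ∀ u : unitInterval, ∫⁻ t,
              {w : Field s | ∀ k < n, backbone w k = b' k}.indicator 1 t * g (u, t) *
                finiteMass (s := s) (pairThreshold (u, t)) Set.univ ^ (s - 1) ∂weightLaw s =
              (s : ENNReal)⁻¹ ^ n * ∫⁻ t, g (u, t) *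
                finiteMass (s := s) (pairThreshold (u, t)) Set.univ ^ (s - 1) ∂weightLaw s := by
            intro u
            -- Once the first weight `u` is fixed, the other factors depend on the subtree only
            -- through its `forward` sequence, so they form a new test function for the induction
            -- hypothesis.
            have hf' : Measurable fun W : ℕ → unitInterval => f (consSeq (u ⊔ W 0) W) *
                finiteMass (s := s) (u ⊔ W 0) Set.univ ^ (s - 1) := by
              have h0 : Measurable fun W : ℕ → unitInterval => u ⊔ W 0 :=
                measurable_const.sup (measurable_pi_apply 0)
              exact (hf.comp (measurable_consSeq.comp (h0.prodMk measurable_id))).mul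
                ((hmass.comp h0).pow_const _)
            have := ih b' hf'
            simp only [mul_assoc]
            exact this
          simp only [h5]
          rw [lintegral_const_mul _ hgm.lintegral_prod_right', ← lintegral_dirLaw hgm]
        · simp only [H, if_neg hi]
          simp
      simp only [h4, Finset.sum_ite_eq', Finset.mem_univ, if_true] at h3
      rw [← h3]
      refine lintegral_congr fun w => ?_
      have hset : w ∈ {w : Field s | ∀ k < n + 1, backbone w k = b k} ↔
          firstStep w = b 0 ∧ (dirField (firstStep w) w).2 ∈
            {w : Field s | ∀ k < n, backbone w k = b' k} := by
        constructor
        · exact fun h => ⟨h 0 (Nat.succ_pos n), fun k hk => h (k + 1) (by omega)⟩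
        · rintro ⟨h0, h⟩ (_ | k) hk
          · exact h0
          · exact h k (by omega)
      have hfw : f (forward w) = g (dirField (firstStep w) w) := congrArg f (forward_eq_consSeq w)
      rw [hfw]
      by_cases hi : firstStep w = b 0
      · simp only [H, if_pos hi]
        congr 1
        by_cases hm : (dirField (firstStep w) w).2 ∈
            {w : Field s | ∀ k < n, backbone w k = b' k}
        · rw [Set.indicator_of_mem hm, Set.indicator_of_mem (hset.2 ⟨hi, hm⟩)]
          rfl
        · rw [Set.indicator_of_notMem hm, Set.indicator_of_notMem fun h => hm (hset.1 h).2]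
      · simp only [H, if_neg hi]
        rw [Set.indicator_of_notMem fun h => hi (hset.1 h).1, zero_mul]
    rw [h2, h1, pow_succ, mul_assoc, ← mul_assoc (s : ENNReal)⁻¹,
      ENNReal.inv_mul_cancel hs0 (ENNReal.natCast_ne_top s), one_mul]

/-- The probability that the forward thresholds do not change in `n` steps. -/
lemma lintegral_forward_const (hs : 2 ≤ s) (n : ℕ) {f : unitInterval → ENNReal}
    (hf : Measurable f) :
    ∫⁻ w, {w : Field s | forward w n = forward w 0}.indicator 1 w * f (forward w n) ∂weightLaw s =
      ∫⁻ w, (s * (ENNReal.ofReal (threshold w) *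
        finiteMass (s := s) (threshold w) Set.univ ^ (s - 1))) ^ n * f (threshold w)
          ∂weightLaw s := by
  have hmass := measurable_finiteMass (s := s) MeasurableSet.univ
  -- `finiteMass p univ` is `ζ(p)`, so `c p` is `s` times the dual parameter; each step without
  -- change of threshold contributes one such factor.
  let c : unitInterval → ENNReal := fun p =>
    s * (ENNReal.ofReal p * finiteMass (s := s) p Set.univ ^ (s - 1))
  have hc : Measurable c := by
    refine measurable_const.mul (Measurable.mul ?_ (hmass.pow_const _))
    exact ENNReal.measurable_ofReal.comp measurable_subtype_coe
  have hmeas : ∀ n, MeasurableSet {w : Field s | forward w n = forward w 0} := fun n =>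
    measurableSet_eq_fun (by fun_prop) (by fun_prop)
  induction n generalizing f with
  | zero => simp [forward]
  | succ n ih =>
    let G : unitInterval × Field s → ENNReal := fun y =>
      {y : unitInterval × Field s | forward y.2 n = pairThreshold y}.indicator 1 y *
        f (forward y.2 n)
    have hG : Measurable G := by
      refine Measurable.mul (measurable_one.indicator (measurableSet_eq_fun ?_
        measurable_pairThreshold)) (hf.comp ?_) <;>
      exact (measurable_pi_apply n).comp (measurable_forward.comp measurable_snd)
    have h1 := lintegral_firstStep' hs (G := fun _ => G) fun _ => hG
    rw [Finset.sum_const, Finset.card_univ, Fintype.card_fin, nsmul_eq_mul] at h1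
    have h2 : ∫⁻ w, {w : Field s | forward w (n + 1) = forward w 0}.indicator 1 w *
        f (forward w (n + 1)) ∂weightLaw s =
        ∫⁻ w, G (dirField (firstStep w) w) ∂weightLaw s := by
      refine lintegral_congr fun w => ?_
      have h0 : forward w 0 = pairThreshold (dirField (firstStep w) w) :=
        (dirThreshold_firstStep w).symm
      change {w : Field s | forward w (n + 1) = forward w 0}.indicator 1 w * f (forward w (n + 1)) =
        {y : unitInterval × Field s | forward y.2 n = pairThreshold y}.indicator 1
          (dirField (firstStep w) w) * f (forward w (n + 1))
      congr 1
      by_cases h : forward w (n + 1) = forward w 0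
      · rw [Set.indicator_of_mem (s := {w : Field s | forward w (n + 1) = forward w 0}) h,
          Set.indicator_of_mem (a := dirField (firstStep w) w)
            (s := {y : unitInterval × Field s | forward y.2 n = pairThreshold y}) (h.trans h0)]
        rfl
      · rw [Set.indicator_of_notMem (s := {w : Field s | forward w (n + 1) = forward w 0}) h,
          Set.indicator_of_notMem (a := dirField (firstStep w) w)
            (s := {y : unitInterval × Field s | forward y.2 n = pairThreshold y})
            fun h' => h (Eq.trans h' h0.symm)]
    have h3 : ∀ t : Field s, ∫⁻ u : unitInterval, G (u, t) *
        finiteMass (s := s) (pairThreshold (u, t)) Set.univ ^ (s - 1) =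
        {w : Field s | forward w n = forward w 0}.indicator 1 t *
          (ENNReal.ofReal (forward t n) * finiteMass (s := s) (forward t n) Set.univ ^ (s - 1) *
            f (forward t n)) := by
      intro t
      have hle : forward t n ≤ forward t 0 := forward_antitone t (Nat.zero_le n)
      have h4 : ∀ u : unitInterval, G (u, t) *
          finiteMass (s := s) (pairThreshold (u, t)) Set.univ ^ (s - 1) =
          (Set.Iic (forward t n)).indicator 1 u *
            ({w : Field s | forward w n = forward w 0}.indicator 1 t *
            (finiteMass (s := s) (forward t n) Set.univ ^ (s - 1) * f (forward t n))) := by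
        intro u
        -- The first edge leaves the threshold unchanged exactly when `u` does not exceed it;
        -- integrating over the uniform `u` gives the factor `p` in `c p`.
        have hiff : forward t n = pairThreshold (u, t) ↔
            u ≤ forward t n ∧ forward t n = forward t 0 := by
          change forward t n = u ⊔ forward t 0 ↔ _
          constructor
          · intro h
            exact ⟨h.symm ▸ le_sup_left, le_antisymm hle (h.symm ▸ le_sup_right)⟩
          · rintro ⟨h, h'⟩
            rw [← h', sup_eq_right.2 h]
        by_cases h : forward t n = pairThreshold (u, t)
        · obtain ⟨h5, h6⟩ := hiff.1 h
          simp only [G]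
          rw [Set.indicator_of_mem (a := (u, t))
              (s := {y : unitInterval × Field s | forward y.2 n = pairThreshold y}) h,
            Set.indicator_of_mem (show u ∈ Set.Iic (forward t n) from h5),
            Set.indicator_of_mem (s := {w : Field s | forward w n = forward w 0}) h6, ← h]
          simp [mul_comm]
        · simp only [G]
          rw [Set.indicator_of_notMem (a := (u, t))
            (s := {y : unitInterval × Field s | forward y.2 n = pairThreshold y}) h]
          by_cases h5 : u ≤ forward t n
          · rw [Set.indicator_of_notMem (s := {w : Field s | forward w n = forward w 0})
              fun h6 => h (hiff.2 ⟨h5, h6⟩)]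
            simp
          · rw [Set.indicator_of_notMem (show u ∉ Set.Iic (forward t n) from h5)]
            simp
      simp only [h4]
      rw [lintegral_mul_const _ (measurable_one.indicator measurableSet_Iic),
        lintegral_indicator_one measurableSet_Iic, unitInterval.volume_Iic]
      ring
    have hGm : Measurable fun y : unitInterval × Field s =>
        G y * finiteMass (s := s) (pairThreshold y) Set.univ ^ (s - 1) :=
      hG.mul ((hmass.comp measurable_pairThreshold).pow_const _)
    rw [h2, h1, dirLaw, lintegral_prod_symm _ hGm.aemeasurable]
    simp only [h3]
    have h5 := ih (f := fun p => c p * f p) (hc.mul hf)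
    rw [← lintegral_const_mul]
    · refine Eq.trans (lintegral_congr fun w => ?_) (h5.trans (lintegral_congr fun w => ?_))
      · simp only [c]; ring
      · simp only [c]; ring
    · have hfn : Measurable fun w : Field s => forward w n := by fun_prop
      refine (measurable_one.indicator (hmeas n)).mul (Measurable.mul (Measurable.mul ?_ ?_) ?_)
      · exact ENNReal.measurable_ofReal.comp (measurable_subtype_coe.comp hfn)
      · exact (hmass.comp hfn).pow_const _
      · exact hf.comp hfn

/-- Given the backbone and the forward thresholds, the branches are independent percolation
clusters conditioned to be finite. -/
lemma lintegral_offBranch (hs : 2 ≤ s) (n : ℕ) {A : ℕ → Fin s → Set (Set (Vertex s))}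
    (hA : ∀ k j, MeasurableSet (A k j)) {f : (ℕ → Fin s) × (ℕ → unitInterval) → ENNReal}
    (hf : Measurable f) :
    ∫⁻ w, f (backbone w, forward w) * ∏ k ∈ Finset.range n, ∏ j with j ≠ backbone w k,
        (A k j).indicator 1 (offBranch w k j) ∂weightLaw s =
      ∫⁻ w, f (backbone w, forward w) * ∏ k ∈ Finset.range n, ∏ j with j ≠ backbone w k,
        finiteBranchLaw (forward w k) j (A k j) ∂weightLaw s := by
  induction n generalizing A f with
  | zero => simp
  | succ n ih =>
    have hpair : Measurable fun y : unitInterval × Field s =>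
        consSeq (pairThreshold y) (forward y.2) := measurable_consSeq.comp
      (measurable_pairThreshold.prodMk (measurable_forward.comp measurable_snd))
    have hcons : ∀ i : Fin s, Measurable fun y : unitInterval × Field s =>
        consSeq i (backbone y.2) := fun i => measurable_consSeq.comp
      (measurable_const.prodMk (measurable_backbone.comp measurable_snd))
    have hbb : ∀ k, Measurable fun w : Field s => backbone w k := fun k => by fun_prop
    have hfw : ∀ k, Measurable fun w : Field s => forward w k := fun k => by fun_prop
    let E : Field s → ENNReal := fun t => ∏ k ∈ Finset.range n, ∏ j with j ≠ backbone t k,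
      (A (k + 1) j).indicator 1 (offBranch t k j)
    let D : Field s → ENNReal := fun t => ∏ k ∈ Finset.range n, ∏ j with j ≠ backbone t k,
      finiteBranchLaw (forward t k) j (A (k + 1) j)
    have hE : Measurable E := Finset.measurable_fun_prod _ fun k _ => measurable_prod_ne
      (fun j => (measurable_one.indicator (hA _ j)).comp (measurable_offBranch k j)) (hbb k)
    have hD : Measurable D := Finset.measurable_fun_prod _ fun k _ => measurable_prod_ne
      (fun j => (measurable_finiteBranchLaw j (hA _ j)).comp (hfw k)) (hbb k)
    let g : Fin s → unitInterval × Field s → ENNReal := fun i y =>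
      f (consSeq i (backbone y.2), consSeq (pairThreshold y) (forward y.2))
    have hg : ∀ i, Measurable (g i) := fun i => hf.comp ((hcons i).prodMk hpair)
    have hL := lintegral_firstStep hs (G := fun i y => g i y * E y.2)
      (fun i => (hg i).mul (hE.comp measurable_snd)) (hA 0)
    have hlaw : ∀ i, Measurable fun y : unitInterval × Field s =>
        ∏ j with j ≠ i, finiteBranchLaw (pairThreshold y) j (A 0 j) := fun i =>
      Finset.measurable_fun_prod _ fun j _ =>
        (measurable_finiteBranchLaw j (hA 0 j)).comp measurable_pairThreshold
    -- Unconstrained sets on this side supply the mass of the event that the other directions lose,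
    -- which `finiteMass_eq` combines with the conditional laws to match `hL`.
    have hR := lintegral_firstStep hs (G := fun i y => g i y * D y.2 *
        ∏ j with j ≠ i, finiteBranchLaw (pairThreshold y) j (A 0 j))
      (fun i => ((hg i).mul (hD.comp measurable_snd)).mul (hlaw i))
      (A := fun _ => Set.univ) fun _ => MeasurableSet.univ
    have hfg : ∀ w : Field s, f (backbone w, forward w) =
        g (firstStep w) (dirField (firstStep w) w) := fun w =>
      congrArg f (Prod.ext (backbone_eq_consSeq w) (forward_eq_consSeq w))
    have hleft : ∀ w : Field s, f (backbone w, forward w) *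
        ∏ k ∈ Finset.range (n + 1), ∏ j with j ≠ backbone w k,
          (A k j).indicator 1 (offBranch w k j) =
        g (firstStep w) (dirField (firstStep w) w) * E (dirField (firstStep w) w).2 *
          ∏ j with j ≠ firstStep w, (A 0 j).indicator 1 (offBranch w 0 j) := by
      intro w
      rw [Finset.prod_range_succ', hfg, ← mul_assoc]
      rfl
    have hright : ∀ w : Field s, f (backbone w, forward w) *
        ∏ k ∈ Finset.range (n + 1), ∏ j with j ≠ backbone w k,
          finiteBranchLaw (forward w k) j (A k j) =
        g (firstStep w) (dirField (firstStep w) w) * D (dirField (firstStep w) w).2 *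
          (∏ j with j ≠ firstStep w,
            finiteBranchLaw (pairThreshold (dirField (firstStep w) w)) j (A 0 j)) *
          ∏ j with j ≠ firstStep w,
            (Set.univ : Set (Set (Vertex s))).indicator 1 (offBranch w 0 j) := by
      intro w
      rw [Finset.prod_range_succ', hfg, ← mul_assoc]
      have h0 : forward w 0 = pairThreshold (dirField (firstStep w) w) :=
        (dirThreshold_firstStep w).symm
      simp only [Set.indicator_univ, Pi.one_apply, Finset.prod_const_one, mul_one]
      rw [h0]
      rfl
    simp only [hleft, hright]
    rw [hL, hR]
    refine Finset.sum_congr rfl fun i _ => ?_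
    have hprod : ∀ p : unitInterval, ∏ j with j ≠ i, finiteMass p (A 0 j) =
        (∏ j with j ≠ i, finiteBranchLaw p j (A 0 j)) *
          ∏ j with j ≠ i, finiteMass (s := s) p Set.univ := by
      intro p
      rw [← Finset.prod_mul_distrib]
      exact Finset.prod_congr rfl fun j _ => finiteMass_eq p j (hA 0 j)
    have hmassm : ∀ i : Fin s, Measurable fun p : unitInterval =>
        ∏ j with j ≠ i, finiteMass p (A 0 j) := fun i =>
      Finset.measurable_fun_prod _ fun j _ => measurable_finiteMass (hA 0 j)
    have hmassm' : Measurable fun y : unitInterval × Field s =>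
        ∏ j with j ≠ i, finiteMass (pairThreshold y) (A 0 j) :=
      (hmassm i).comp measurable_pairThreshold
    simp only [mul_assoc, ← hprod]
    rw [lintegral_dirLaw (G := fun y => g i y * (E y.2 *
        ∏ j with j ≠ i, finiteMass (pairThreshold y) (A 0 j)))
        ((hg i).mul ((hE.comp measurable_snd).mul hmassm')),
      lintegral_dirLaw (G := fun y => g i y * (D y.2 *
        ∏ j with j ≠ i, finiteMass (pairThreshold y) (A 0 j)))
        ((hg i).mul ((hD.comp measurable_snd).mul hmassm'))]
    refine lintegral_congr fun u => ?_
    -- For fixed `u` the product at the root depends on the subtree only through its first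
    -- threshold, so the test function of the induction hypothesis absorbs it.
    have hf' : Measurable fun q : (ℕ → Fin s) × (ℕ → unitInterval) =>
        f (consSeq i q.1, consSeq (u ⊔ q.2 0) q.2) *
          ∏ j with j ≠ i, finiteMass (u ⊔ q.2 0) (A 0 j) := by
      have h0 : Measurable fun q : (ℕ → Fin s) × (ℕ → unitInterval) => u ⊔ q.2 0 :=
        measurable_const.sup ((measurable_pi_apply 0).comp measurable_snd)
      refine (hf.comp (Measurable.prodMk ?_ ?_)).mul ((hmassm i).comp h0)
      · exact measurable_consSeq.comp (measurable_const.prodMk measurable_fst)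
      · exact measurable_consSeq.comp (h0.prodMk measurable_snd)
    have h := ih (A := fun k => A (k + 1)) (fun k j => hA (k + 1) j) hf'
    refine Eq.trans (lintegral_congr fun t => ?_) (h.trans (lintegral_congr fun t => ?_))
    · rw [mul_comm (E t), ← mul_assoc]
      rfl
    · rw [mul_comm (D t), ← mul_assoc]
      rfl

end Markov

/-! ### Almost every weight field is good. -/

section AlmostSure

variable {s : ℕ}

/-- Since there are countably many vertices, an almost sure property at the root also holds at the
random vertices of the backbone. -/
lemma ae_forall_shift {P : Field s → Prop} (h : ∀ᵐ w ∂weightLaw s, P w) :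
    ∀ᵐ w ∂weightLaw s, ∀ v, P (shift v w) :=
  ae_all_iff.2 fun v => (measurePreserving_shift v).quasiMeasurePreserving.ae h

variable [NeZero s]

lemma ae_lt_threshold (hs : 2 ≤ s) : ∀ᵐ w ∂weightLaw s, 1 / (s : ℝ) < threshold w := by
  have h : ∀ᵐ w ∂weightLaw s, ∀ i, 1 / (s : ℝ) < dirThreshold w i :=
    ae_all_iff.2 (ae_lt_dirThreshold hs)
  filter_upwards [h] with w hw
  rw [← dirThreshold_firstStep]
  exact hw _

lemma ae_threshold_lt_one (hs : 2 ≤ s) : ∀ᵐ w ∂weightLaw s, threshold w < 1 := by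
  have h : ∀ᵐ w ∂weightLaw s, ∀ i, dirThreshold w i ≠ 1 := by
    refine ae_all_iff.2 fun i => ?_
    rw [ae_iff]
    simpa only [not_not] using weightLaw_dirThreshold_eq hs i 1
  filter_upwards [h] with w hw
  rw [← dirThreshold_firstStep]
  exact lt_of_le_of_ne unitInterval.le_one' (hw _)

/-- The probability of no change in `n` steps is the mean of `c ^ n`. As thresholds are
supercritical, `dual_lt` gives `c < 1` almost surely, and dominated convergence applies. -/
lemma ae_exists_forward_lt (hs : 2 ≤ s) :
    ∀ᵐ w ∂weightLaw s, ∃ n, forward w n < forward w 0 := by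
  let c : Field s → ENNReal := fun w =>
    s * (ENNReal.ofReal (threshold w) * finiteMass (s := s) (threshold w) Set.univ ^ (s - 1))
  have hc : Measurable c := by
    refine measurable_const.mul (Measurable.mul ?_ (Measurable.pow_const ?_ _))
    · exact ENNReal.measurable_ofReal.comp (measurable_subtype_coe.comp measurable_threshold)
    · exact (measurable_finiteMass MeasurableSet.univ).comp measurable_threshold
  have hc1 : ∀ᵐ w ∂weightLaw s, c w < 1 := by
    filter_upwards [ae_lt_threshold hs] with w hw
    have hz : finiteMass (s := s) (threshold w) Set.univ =
        ENNReal.ofReal (zeta (threshold w) (0 : Fin s)) := by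
      rw [finiteMass_univ, coe_zeta_eq_dirLaw, ofReal_measureReal]
    have hlt := dual_lt hs hw (0 : Fin s)
    rw [lt_div_iff₀ (by positivity), coe_dual] at hlt
    simp only [c]
    rw [hz, ← ENNReal.ofReal_pow (zeta _ _).2.1, ← ENNReal.ofReal_mul (threshold w).2.1,
      ← ENNReal.ofReal_natCast, ← ENNReal.ofReal_mul (Nat.cast_nonneg s), ENNReal.ofReal_lt_one,
      mul_comm]
    exact hlt
  have hmeas : ∀ n, MeasurableSet {w : Field s | forward w n = forward w 0} := fun n =>
    measurableSet_eq_fun (by fun_prop) (by fun_prop)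
  have hprob : ∀ n, weightLaw s {w | forward w n = forward w 0} = ∫⁻ w, c w ^ n ∂weightLaw s := by
    intro n
    have h := lintegral_forward_const hs n (f := fun _ => 1) measurable_const
    simp only [mul_one] at h
    rw [← h]
    exact (lintegral_indicator_one (hmeas n)).symm
  have hlim : Filter.Tendsto (fun n => ∫⁻ w, c w ^ n ∂weightLaw s) Filter.atTop (nhds 0) := by
    have h := tendsto_lintegral_of_dominated_convergence (μ := weightLaw s)
      (F := fun n w => c w ^ n) (f := fun _ => 0) (fun _ => 1) (fun n => hc.pow_const n)
      (fun n => hc1.mono fun w hw => pow_le_one₀ (zero_le) hw.le) (by simp)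
      (hc1.mono fun w hw => ENNReal.tendsto_pow_atTop_nhds_zero_of_lt_one hw)
    simpa using h
  have hnull : weightLaw s {w | ∀ n, forward w n = forward w 0} = 0 := by
    refine le_antisymm (ge_of_tendsto' hlim fun n => ?_) zero_le
    rw [← hprob n]
    exact measure_mono (Set.ofPred_subset_ofPred.2 fun w hw => hw n)
  rw [ae_iff]
  refine measure_mono_null (Set.ofPred_subset_ofPred.2 fun w hw n => ?_) hnull
  push Not at hw
  exact le_antisymm (forward_antitone w (Nat.zero_le n)) (hw n)

lemma ae_good (hs : 2 ≤ s) : ∀ᵐ w ∂weightLaw s, Good w := by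
  have hne : ∀ᵐ w ∂weightLaw s, ∀ i j : Fin s, i ≠ j → dirThreshold w i ≠ dirThreshold w j := by
    refine ae_all_iff.2 fun i => ae_all_iff.2 fun j => ?_
    by_cases hij : i = j
    · simp [hij]
    · simpa [hij] using ae_dirThreshold_ne hs hij
  filter_upwards [ae_weights_injective, ae_forall_shift hne,
    ae_forall_shift (ae_exists_forward_lt hs)] with w h1 h2 h3
  refine ⟨h1, h2, fun k => ?_⟩
  obtain ⟨n, hn⟩ := h3 (rayVertex (backbone w) k)
  rw [← advance_iterate] at hn
  refine ⟨k + n, Nat.le_add_right k n, ?_⟩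
  have h4 : forward w (k + n) = forward (advance^[k] w) n := by
    rw [forward, forward, ← Function.iterate_add_apply, add_comm]
  rw [h4]
  exact hn

lemma ae_forward_bounds (hs : 2 ≤ s) :
    ∀ᵐ w ∂weightLaw s, ∀ k, 1 / (s : ℝ) < forward w k ∧ forward w k < 1 := by
  filter_upwards [ae_forall_shift (ae_lt_threshold hs), ae_forall_shift (ae_threshold_lt_one hs)]
    with w h1 h2 k
  rw [forward, advance_iterate]
  exact ⟨h1 _, h2 _⟩

end AlmostSure

/-! ### Independence of the backbone from the forward thresholds. -/

section Independence

variable {s : ℕ}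

lemma rayVertex_eq_iff {b b' : ℕ → Fin s} {n : ℕ} :
    rayVertex b n = rayVertex b' n ↔ ∀ k < n, b k = b' k := by
  refine ⟨fun h => ?_, rayVertex_congr⟩
  induction n with
  | zero => simp
  | succ n ih =>
    simp only [rayVertex, List.cons.injEq] at h
    intro k hk
    rcases Nat.lt_succ_iff_lt_or_eq.1 hk with hk | rfl
    · exact ih h.2 k hk
    · exact h.1

lemma exists_rayVertex_eq [NeZero s] (v : Vertex s) :
    ∃ b : ℕ → Fin s, rayVertex b v.length = v := by
  classical
  induction v with
  | nil => exact ⟨fun _ => 0, rfl⟩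
  | cons i v ih =>
    obtain ⟨b, hb⟩ := ih
    refine ⟨Function.update b v.length i, ?_⟩
    have h : rayVertex (Function.update b v.length i) v.length = rayVertex b v.length :=
      rayVertex_congr fun j hj => Function.update_of_ne hj.ne _ _
    rw [List.length_cons, rayVertex, h, hb, Function.update_self]

lemma measurableSet_rayVertex (n : ℕ) (v : Vertex s) :
    MeasurableSet {b : ℕ → Fin s | rayVertex b n = v} := by
  induction n generalizing v with
  | zero => exact MeasurableSet.const ([] = v)
  | succ n ih =>
    cases v with
    | nil => simp [rayVertex]
    | cons i v =>
      have h : {b : ℕ → Fin s | rayVertex b (n + 1) = i :: v} =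
          {b | b n = i} ∩ {b | rayVertex b n = v} := by
        ext b; simp [rayVertex]
      rw [h]
      exact (measurableSet_eq_fun (measurable_pi_apply n) measurable_const).inter (ih v)

lemma generateFrom_rayVertex :
    (MeasurableSpace.pi : MeasurableSpace (ℕ → Fin s)) =
      MeasurableSpace.generateFrom {S | ∃ v : Vertex s, S = {b | rayVertex b v.length = v}} := by
  apply le_antisymm
  · refine iSup_le fun k => ?_
    rintro _ ⟨t, -, rfl⟩
    have : (fun b : ℕ → Fin s => b k) ⁻¹' t =
        ⋃ (v : Vertex s) (_ : ∃ i ∈ t, ∃ u : Vertex s, u.length = k ∧ v = i :: u),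
          {b | rayVertex b v.length = v} := by
      ext b
      simp only [Set.mem_preimage, Set.mem_iUnion, exists_prop]
      constructor
      · intro hb
        exact ⟨rayVertex b (k + 1), ⟨b k, hb, rayVertex b k, by simp, rfl⟩,
          show rayVertex b (rayVertex b (k + 1)).length = rayVertex b (k + 1) by
            rw [rayVertex_length]⟩
      · rintro ⟨_, ⟨i, hi, u, rfl, rfl⟩, h⟩
        have h' : rayVertex b (u.length + 1) = i :: u := h
        simp only [rayVertex, List.cons.injEq] at h'
        rwa [h'.1]
    rw [this]
    exact MeasurableSet.iUnion fun v => MeasurableSet.iUnion fun _ =>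
      MeasurableSpace.measurableSet_generateFrom ⟨v, rfl⟩
  · refine MeasurableSpace.generateFrom_le ?_
    rintro _ ⟨v, rfl⟩
    exact measurableSet_rayVertex v.length v

/-- Two cylinders of rays are nested or disjoint. -/
lemma isPiSystem_rayVertex :
    IsPiSystem {S | ∃ v : Vertex s, S = {b : ℕ → Fin s | rayVertex b v.length = v}} := by
  have key : ∀ u v : Vertex s, u.length ≤ v.length →
      ({b : ℕ → Fin s | rayVertex b u.length = u} ∩ {b | rayVertex b v.length = v}).Nonempty →
      {b : ℕ → Fin s | rayVertex b u.length = u} ∩ {b | rayVertex b v.length = v} =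
        {b | rayVertex b v.length = v} := by
    rintro u v huv ⟨b, hu, hv⟩
    refine Set.inter_eq_right.2 fun b' hb' => ?_
    have h1 : rayVertex b' v.length = rayVertex b v.length := Eq.trans hb' (Eq.symm hv)
    have h2 := rayVertex_eq_iff.1 h1
    exact Eq.trans (rayVertex_congr fun j hj => h2 j (by omega)) hu
  rintro _ ⟨u, rfl⟩ _ ⟨v, rfl⟩ hne
  rcases le_total u.length v.length with h | h
  · exact ⟨v, key u v h hne⟩
  · rw [Set.inter_comm] at hne ⊢
    exact ⟨u, key v u h hne⟩

lemma weightLaw_rayVertex_inter [NeZero s] (hs : 2 ≤ s) (v : Vertex s) {S : Set (ℕ → unitInterval)}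
    (hS : MeasurableSet S) :
    weightLaw s ({w | rayVertex (backbone w) v.length = v} ∩ forward ⁻¹' S) =
      (s : ENNReal)⁻¹ ^ v.length * weightLaw s (forward ⁻¹' S) := by
  obtain ⟨b, hb⟩ := exists_rayVertex_eq v
  have h := lintegral_backbone_prefix hs v.length b
    (f := S.indicator 1) (measurable_one.indicator hS)
  have hset : {w : Field s | rayVertex (backbone w) v.length = v} =
      {w | ∀ k < v.length, backbone w k = b k} := by
    ext w
    change rayVertex (backbone w) v.length = v ↔ ∀ k < v.length, backbone w k = b k
    rw [← rayVertex_eq_iff, hb]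
  have hm : MeasurableSet {w : Field s | rayVertex (backbone w) v.length = v} :=
    measurable_backbone (measurableSet_rayVertex v.length v)
  have hmS : MeasurableSet (forward (s := s) ⁻¹' S) := measurable_forward hS
  rw [← hset] at h
  have h2 : ∫⁻ w, S.indicator 1 (forward w) ∂weightLaw s = weightLaw s (forward ⁻¹' S) :=
    lintegral_indicator_one hmS
  rw [h2] at h
  rw [← h, ← lintegral_indicator_one (hm.inter hmS), Set.inter_indicator_one]
  rfl

lemma indepFun_backbone_forward [NeZero s] (hs : 2 ≤ s) :
    IndepFun (backbone (s := s)) forward (weightLaw s) := by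
  rw [indepFun_iff_measure_inter_preimage_eq_mul]
  intro B S hB hS
  have hmS : MeasurableSet (forward (s := s) ⁻¹' S) := measurable_forward hS
  -- For fixed `S` two finite measures on rays are compared; they agree on cylinders, where the
  -- backbone is uniform with or without the event `S`.
  have h : ((weightLaw s).restrict (forward ⁻¹' S)).map backbone =
      weightLaw s (forward ⁻¹' S) • (weightLaw s).map backbone := by
    refine ext_of_generate_finite _ generateFrom_rayVertex isPiSystem_rayVertex ?_ ?_
    · rintro _ ⟨v, rfl⟩
      have hm : MeasurableSet {b : ℕ → Fin s | rayVertex b v.length = v} :=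
        measurableSet_rayVertex v.length v
      have h1 := weightLaw_rayVertex_inter hs v hS
      have h2 := weightLaw_rayVertex_inter hs v MeasurableSet.univ
      rw [Set.preimage_univ, Set.inter_univ, measure_univ, mul_one] at h2
      rw [Measure.map_apply measurable_backbone hm, Measure.restrict_apply (measurable_backbone hm),
        Measure.smul_apply, Measure.map_apply measurable_backbone hm, smul_eq_mul]
      refine Eq.trans h1 ?_
      rw [← h2, mul_comm]
      rfl
    · rw [Measure.map_apply measurable_backbone .univ, Measure.smul_apply,
        Measure.map_apply measurable_backbone .univ]
      simp
  have h' := congrArg (fun ν => ν B) h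
  simp only [Measure.smul_apply, smul_eq_mul] at h'
  rw [Measure.map_apply measurable_backbone hB, Measure.map_apply measurable_backbone hB,
    Measure.restrict_apply (measurable_backbone hB)] at h'
  rw [h', mul_comm]

end Independence

/-! ### Joint law of finitely many branches. -/

section Branches

variable {s : ℕ}

lemma prod_range_prod_ite {M : Type*} [CommMonoid M] (F : Finset (ℕ × Fin s)) {n : ℕ}
    (hn : ∀ x ∈ F, x.1 < n) (c : ℕ → Fin s) (h : ℕ × Fin s → M) :
    ∏ k ∈ Finset.range n, ∏ j with j ≠ c k, (if (k, j) ∈ F then h (k, j) else 1) =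
      ∏ x ∈ F with x.2 ≠ c x.1, h x := by
  have hF : F = (Finset.range n ×ˢ Finset.univ).filter fun x => x ∈ F := by
    ext x
    simp only [Finset.mem_filter, Finset.mem_product, Finset.mem_range, Finset.mem_univ, and_true]
    exact ⟨fun hx => ⟨hn x hx, hx⟩, fun hx => hx.2⟩
  conv_rhs => rw [hF]
  rw [Finset.filter_filter, Finset.prod_filter, Finset.prod_product]
  refine Finset.prod_congr rfl fun k _ => ?_
  rw [Finset.prod_filter]
  refine Finset.prod_congr rfl fun j _ => ?_
  by_cases h1 : j ≠ c k <;> by_cases h2 : (k, j) ∈ F <;> simp [h1, h2]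

lemma prod_indicator_one [NeZero s] (F : Finset (ℕ × Fin s))
    (A : ℕ × Fin s → Set (Set (Vertex s))) (w : Field s) :
    ∏ x ∈ F with x.2 ≠ backbone w x.1, (A x).indicator (1 : Set (Vertex s) → ENNReal)
        (offBranch w x.1 x.2) =
      {w : Field s | ∀ x ∈ F, x.2 ≠ backbone w x.1 → offBranch w x.1 x.2 ∈ A x}.indicator 1 w := by
  by_cases h : ∀ x ∈ F, x.2 ≠ backbone w x.1 → offBranch w x.1 x.2 ∈ A x
  · rw [Set.indicator_of_mem (a := w) (s := {w : Field s |
      ∀ x ∈ F, x.2 ≠ backbone w x.1 → offBranch w x.1 x.2 ∈ A x}) h]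
    refine Finset.prod_eq_one fun x hx => ?_
    rw [Finset.mem_filter] at hx
    rw [Set.indicator_of_mem (h x hx.1 hx.2)]
    rfl
  · rw [Set.indicator_of_notMem (a := w) (s := {w : Field s |
      ∀ x ∈ F, x.2 ≠ backbone w x.1 → offBranch w x.1 x.2 ∈ A x}) h]
    push Not at h
    obtain ⟨x, hx, h1, h2⟩ := h
    exact Finset.prod_eq_zero (Finset.mem_filter.2 ⟨hx, h1⟩) (Set.indicator_of_notMem h2 _)

variable [NeZero s]

lemma lintegral_offBranch_finset (hs : 2 ≤ s) (F : Finset (ℕ × Fin s))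
    {A : ℕ × Fin s → Set (Set (Vertex s))} (hA : ∀ x, MeasurableSet (A x))
    {f : (ℕ → Fin s) × (ℕ → unitInterval) → ENNReal} (hf : Measurable f) :
    ∫⁻ w, f (backbone w, forward w) *
        {w : Field s | ∀ x ∈ F, x.2 ≠ backbone w x.1 → offBranch w x.1 x.2 ∈ A x}.indicator 1 w
          ∂weightLaw s =
      ∫⁻ w, f (backbone w, forward w) * ∏ x ∈ F with x.2 ≠ backbone w x.1,
        finiteBranchLaw (forward w x.1) x.2 (A x) ∂weightLaw s := by
  classical
  obtain ⟨N, hN⟩ := (F.image Prod.fst).bddAbove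
  have hn : ∀ x ∈ F, x.1 < N + 1 := fun x hx =>
    Nat.lt_succ_of_le (hN (Finset.mem_coe.2 (Finset.mem_image_of_mem _ hx)))
  have h := lintegral_offBranch hs (N + 1)
    -- Pairs outside `F` get no constraint; their factors are `1` since `finiteBranchLaw` is a
    -- probability measure when `forward w k < 1`.
    (A := fun k j => if (k, j) ∈ F then A (k, j) else Set.univ)
    (fun k j => by split_ifs; exacts [hA _, MeasurableSet.univ]) hf
  refine Eq.trans (lintegral_congr fun w => ?_) (h.trans (lintegral_congr_ae ?_))
  · rw [← prod_indicator_one, ← prod_range_prod_ite F hn]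
    congr 1
    refine Finset.prod_congr rfl fun k _ => Finset.prod_congr rfl fun j _ => ?_
    split_ifs <;> simp
  · filter_upwards [ae_forward_bounds hs] with w hw
    rw [← prod_range_prod_ite F hn]
    congr 1
    refine Finset.prod_congr rfl fun k _ => Finset.prod_congr rfl fun j _ => ?_
    have := isProbabilityMeasure_finiteBranchLaw (hw k).2 j
    split_ifs <;> simp

lemma measurableSet_offBranch (F : Finset (ℕ × Fin s))
    {A : ℕ × Fin s → Set (Set (Vertex s))} (hA : ∀ x, MeasurableSet (A x)) :
    MeasurableSet {w : Field s | ∀ x ∈ F, x.2 ≠ backbone w x.1 → offBranch w x.1 x.2 ∈ A x} := by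
  have : {w : Field s | ∀ x ∈ F, x.2 ≠ backbone w x.1 → offBranch w x.1 x.2 ∈ A x} =
      ⋂ x ∈ F, ({w | x.2 = backbone w x.1} ∪ {w | offBranch w x.1 x.2 ∈ A x}) := by
    ext w
    simp only [Set.mem_ofPred_eq, Set.mem_iInter, Set.mem_union]
    exact forall₂_congr fun x _ => by tauto
  rw [this]
  refine MeasurableSet.biInter F.countable_toSet fun x _ => MeasurableSet.union ?_ ?_
  · exact measurableSet_eq_fun measurable_const (by fun_prop)
  · exact measurable_offBranch x.1 x.2 (hA x)

lemma weightLaw_offBranch_inter (hs : 2 ≤ s) (F : Finset (ℕ × Fin s))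
    {A : ℕ × Fin s → Set (Set (Vertex s))} (hA : ∀ x, MeasurableSet (A x))
    {B : Set ((ℕ → Fin s) × (ℕ → unitInterval))} (hB : MeasurableSet B) :
    weightLaw s ({w | ∀ x ∈ F, x.2 ≠ backbone w x.1 → offBranch w x.1 x.2 ∈ A x} ∩
        {w | (backbone w, forward w) ∈ B}) =
      ∫⁻ w in {w | (backbone w, forward w) ∈ B}, ∏ x ∈ F with x.2 ≠ backbone w x.1,
        finiteBranchLaw (forward w x.1) x.2 (A x) ∂weightLaw s := by
  have h := lintegral_offBranch_finset hs F hA (f := B.indicator 1) (measurable_one.indicator hB)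
  have hBm : MeasurableSet {w : Field s | (backbone w, forward w) ∈ B} :=
    (measurable_backbone.prodMk measurable_forward) hB
  rw [← lintegral_indicator_one ((measurableSet_offBranch F hA).inter hBm),
    ← lintegral_indicator hBm]
  refine Eq.trans (lintegral_congr fun w => ?_) (h.trans (lintegral_congr fun w => ?_))
  · rw [Set.inter_indicator_one, Pi.mul_apply, mul_comm]
    rfl
  · by_cases hw : (backbone w, forward w) ∈ B
    · rw [Set.indicator_of_mem hw, Set.indicator_of_mem
        (s := {w : Field s | (backbone w, forward w) ∈ B}) hw, Pi.one_apply, one_mul]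
    · rw [Set.indicator_of_notMem hw, Set.indicator_of_notMem
        (s := {w : Field s | (backbone w, forward w) ∈ B}) hw, zero_mul]

end Branches

/-! ### Transfer to the given probability space. -/

section Transfer

lemma map_projIcc :
    (volume.restrict (Set.Ioo (0 : ℝ) 1)).map (Set.projIcc (0 : ℝ) 1 zero_le_one) =
      (volume : Measure unitInterval) := by
  have hm : Measurable (Set.projIcc (0 : ℝ) 1 zero_le_one) := continuous_projIcc.measurable
  rw [Measure.restrict_congr_set Ioo_ae_eq_Icc]
  have h : volume.restrict (Set.Icc (0 : ℝ) 1) = (volume : Measure unitInterval).map (↑) :=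
    unitInterval.measurePreserving_coe.map_eq.symm
  rw [h, Measure.map_map hm measurable_subtype_coe]
  have h2 : Set.projIcc (0 : ℝ) 1 zero_le_one ∘ ((↑) : unitInterval → ℝ) = id :=
    funext fun x => Set.projIcc_val zero_le_one x
  rw [h2, Measure.map_id]

variable {s : ℕ} {Ω : Type*} [MeasurableSpace Ω] {μ : Measure Ω}

lemma measurePreserving_projIcc {U : Edge s → Ω → ℝ} (hU : ∀ e, Measurable (U e))
    (hindep : iIndepFun U μ)
    (hunif : ∀ e, μ.map (U e) = volume.restrict (Set.Ioo (0 : ℝ) 1)) :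
    MeasurePreserving (fun ω e => Set.projIcc (0 : ℝ) 1 zero_le_one (U e ω)) μ (weightLaw s) := by
  have hm : Measurable (Set.projIcc (0 : ℝ) 1 zero_le_one) := continuous_projIcc.measurable
  refine ⟨measurable_pi_iff.2 fun e => hm.comp (hU e), ?_⟩
  have h := (hindep.comp (fun _ => Set.projIcc (0 : ℝ) 1 zero_le_one)
    fun _ => hm).map_fun_eq_infinitePi_map fun e => hm.comp (hU e)
  refine Eq.trans h ?_
  rw [weightLaw]
  congr 1
  funext e
  rw [← Measure.map_map hm (hU e), hunif, map_projIcc]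

lemma ae_eq_projIcc {U : Edge s → Ω → ℝ} (hU : ∀ e, Measurable (U e))
    (hunif : ∀ e, μ.map (U e) = volume.restrict (Set.Ioo (0 : ℝ) 1)) :
    ∀ᵐ ω ∂μ, (fun e => U e ω) =
      fun e => (Set.projIcc (0 : ℝ) 1 zero_le_one (U e ω) : ℝ) := by
  have h : ∀ᵐ ω ∂μ, ∀ e, U e ω ∈ Set.Ioo (0 : ℝ) 1 := by
    refine ae_all_iff.2 fun e => ae_of_ae_map (p := fun x => x ∈ Set.Ioo (0 : ℝ) 1)
      (hU e).aemeasurable ?_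
    rw [hunif]
    exact ae_restrict_mem measurableSet_Ioo
  filter_upwards [h] with ω hω
  funext e
  rw [Set.projIcc_of_mem zero_le_one (Set.Ioo_subset_Icc_self (hω e))]

/-- The conditional law of the branches given the backbone and the forward thresholds. -/
lemma condExp_offBranch [IsProbabilityMeasure μ] [NeZero s] (hs : 2 ≤ s) {V : Ω → Field s}
    (hV : MeasurePreserving V μ (weightLaw s)) (F : Finset (ℕ × Fin s))
    {A : ℕ × Fin s → Set (Set (Vertex s))} (hA : ∀ x, MeasurableSet (A x)) :
    μ⟦{ω | ∀ x ∈ F, x.2 ≠ backbone (V ω) x.1 → offBranch (V ω) x.1 x.2 ∈ A x} |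
        MeasurableSpace.comap (fun ω => (backbone (V ω), forward (V ω))) inferInstance⟧
      =ᵐ[μ] fun ω => ∏ x ∈ F with x.2 ≠ backbone (V ω) x.1,
        (finiteBranchLaw (forward (V ω) x.1) x.2).real (A x) := by
  set Y : Ω → (ℕ → Fin s) × (ℕ → unitInterval) := fun ω => (backbone (V ω), forward (V ω)) with hY
  have hYm : Measurable Y := (measurable_backbone.comp hV.measurable).prodMk
    (measurable_forward.comp hV.measurable)
  let E : Set (Field s) :=
    {w | ∀ x ∈ F, x.2 ≠ backbone w x.1 → offBranch w x.1 x.2 ∈ A x}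
  have hE : MeasurableSet E := measurableSet_offBranch F hA
  let g : (ℕ → Fin s) × (ℕ → unitInterval) → ℝ := fun q =>
    ∏ x ∈ F with x.2 ≠ q.1 x.1, (finiteBranchLaw (q.2 x.1) x.2).real (A x)
  have hprodm : ∀ {M : Type} [CommMonoid M] [MeasurableSpace M] [MeasurableMul₂ M]
      {h : ℕ × Fin s → unitInterval → M}, (∀ x, Measurable (h x)) →
      Measurable fun q : (ℕ → Fin s) × (ℕ → unitInterval) =>
        ∏ x ∈ F with x.2 ≠ q.1 x.1, h x (q.2 x.1) := by
    intro M _ _ _ h hh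
    simp only [Finset.prod_filter]
    refine Finset.measurable_fun_prod _ fun x _ => Measurable.ite ?_ ?_ measurable_const
    · exact (measurableSet_eq_fun measurable_const
        ((measurable_pi_apply x.1).comp measurable_fst)).compl
    · exact (hh x).comp ((measurable_pi_apply x.1).comp measurable_snd)
  have hg : Measurable g :=
    hprodm fun x => (measurable_finiteBranchLaw x.2 (hA x)).ennreal_toReal
  have hgE : Measurable fun q : (ℕ → Fin s) × (ℕ → unitInterval) =>
      ∏ x ∈ F with x.2 ≠ q.1 x.1, finiteBranchLaw (q.2 x.1) x.2 (A x) :=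
    hprodm fun x => measurable_finiteBranchLaw x.2 (hA x)
  have hbd : ∀ᵐ ω ∂μ, ∀ k, forward (V ω) k < 1 :=
    (hV.quasiMeasurePreserving.ae (ae_forward_bounds hs)).mono fun ω hω k => (hω k).2
  have hg0 : ∀ q, 0 ≤ g q := fun q => Finset.prod_nonneg fun x _ => measureReal_nonneg
  have hg1 : ∀ᵐ ω ∂μ, ‖g (Y ω)‖ ≤ 1 := by
    filter_upwards [hbd] with ω hω
    rw [Real.norm_of_nonneg (hg0 _)]
    refine Finset.prod_le_one (fun x _ => measureReal_nonneg) fun x _ => ?_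
    have := isProbabilityMeasure_finiteBranchLaw (hω x.1) x.2
    exact measureReal_le_one
  have hgint : Integrable (fun ω => g (Y ω)) μ :=
    Integrable.of_bound (hg.comp hYm).aestronglyMeasurable 1 hg1
  have hofReal : ∀ᵐ ω ∂μ, ENNReal.ofReal (g (Y ω)) =
      ∏ x ∈ F with x.2 ≠ backbone (V ω) x.1, finiteBranchLaw (forward (V ω) x.1) x.2 (A x) := by
    filter_upwards [hbd] with ω hω
    rw [ENNReal.ofReal_prod_of_nonneg fun x _ => measureReal_nonneg]
    refine Finset.prod_congr rfl fun x _ => ?_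
    have := isProbabilityMeasure_finiteBranchLaw (hω x.1) x.2
    exact ofReal_measureReal
  have hEV : MeasurableSet (V ⁻¹' E) := hV.measurable hE
  refine (ae_eq_condExp_of_forall_setIntegral_eq hYm.comap_le ?_ ?_ ?_ ?_).symm
  · exact (integrable_const (1 : ℝ)).indicator hEV
  · exact fun S _ _ => hgint.integrableOn
  -- Sets of the conditioning σ-algebra are preimages `Y ⁻¹' B`, so the defining identity is
  -- `weightLaw_offBranch_inter` carried over by `V`.
  · rintro _ ⟨B, hB, rfl⟩ -
    have hBm : MeasurableSet {w : Field s | (backbone w, forward w) ∈ B} :=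
      (measurable_backbone.prodMk measurable_forward) hB
    have hl : ∫⁻ ω in Y ⁻¹' B, ENNReal.ofReal (g (Y ω)) ∂μ = μ (V ⁻¹' E ∩ Y ⁻¹' B) := by
      rw [lintegral_congr_ae (ae_restrict_of_ae hofReal)]
      have h1 := hV.setLIntegral_comp_preimage hBm
        (hgE.comp (measurable_backbone.prodMk measurable_forward))
      have h2 := hV.measure_preimage (hE.inter hBm).nullMeasurableSet
      exact h1.trans ((weightLaw_offBranch_inter hs F hA hB).symm.trans h2.symm)
    rw [integral_eq_lintegral_of_nonneg_ae (Filter.Eventually.of_forall fun ω => hg0 (Y ω))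
      (hg.comp hYm).aestronglyMeasurable, hl]
    have hr := integral_indicator_one (μ := μ.restrict (Y ⁻¹' B)) hEV
    rw [measureReal_restrict_apply hEV] at hr
    exact hr.symm
  · exact (hg.comp (comap_measurable Y)).aestronglyMeasurable

end Transfer

end InvasionTree

open InvasionTree in
theorem proposition2p1 {s : ℕ} (hs : 2 ≤ s)
    {Ω : Type*} [MeasurableSpace Ω] (μ : Measure Ω) [IsProbabilityMeasure μ]
    (U : Edge s → Ω → ℝ) (hU : ∀ e, Measurable (U e)) (hindep : iIndepFun U μ)
    (hunif : ∀ e, μ.map (U e) = volume.restrict (Set.Ioo (0 : ℝ) 1)) :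
    ∃ (BB : Ω → ℕ → Fin s) (W : Ω → ℕ → unitInterval),
      Measurable BB ∧ Measurable W ∧
      -- `BB` is the only infinite path rising from the root in the cluster
      (∀ᵐ ω ∂μ, ∀ b : ℕ → Fin s,
        (∀ k, rayVertex b k ∈ ipc (fun e => U e ω)) ↔ b = BB ω) ∧
      -- `W k` is the (attained) maximal weight on the backbone above height `k`, and it is
      -- supercritical
      (∀ᵐ ω ∂μ, ∀ k,
        IsGreatest {x : ℝ | ∃ j, k ≤ j ∧ x = U (rayEdge (BB ω) j) ω} (W ω k : ℝ) ∧
        1 / (s : ℝ) < (W ω k : ℝ) ∧ (W ω k : ℝ) < 1) ∧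
      -- the backbone is uniformly random, also given the forward maximal weights
      (∀ (n : ℕ) (v : Vertex s), v.length = n →
        μ.real {ω | rayVertex (BB ω) n = v} = (1 / (s : ℝ)) ^ n) ∧
      IndepFun BB W μ ∧
      -- the cluster consists of the backbone and of the branches in all directions away from it
      (∀ᵐ ω ∂μ, ipc (fun e => U e ω) = Set.range (rayVertex (BB ω)) ∪
        ⋃ (k : ℕ) (i : Fin s) (_ : i ≠ BB ω k),
          (fun u => u ++ i :: rayVertex (BB ω) k) ''
            branch (ipc (fun e => U e ω)) (rayVertex (BB ω) k) i) ∧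
      -- given the backbone and `W`, the branches are independent, and those at height `k` are
      -- percolation clusters with parameter `W k` conditioned to be finite
      (∀ (F : Finset (ℕ × Fin s)) (A : ℕ × Fin s → Set (Set (Vertex s))),
        (∀ x, MeasurableSet (A x)) →
        μ⟦{ω | ∀ x ∈ F, x.2 ≠ BB ω x.1 →
              branch (ipc (fun e => U e ω)) (rayVertex (BB ω) x.1) x.2 ∈ A x} |
            MeasurableSpace.comap (fun ω => (BB ω, W ω)) inferInstance⟧
          =ᵐ[μ] fun ω => ∏ x ∈ F with x.2 ≠ BB ω x.1,
            (finiteBranchLaw (W ω x.1) x.2).real (A x)) ∧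
      -- the latter are subcritical clusters with the dual parameter
      (∀ᵐ ω ∂μ, ∀ (k : ℕ) (i : Fin s),
        (dual (W ω k) i : ℝ) < 1 / (s : ℝ) ∧
        finiteBranchLaw (W ω k) i = branchLaw (dual (W ω k) i) i) := by
  have : NeZero s := ⟨by omega⟩
  -- The projection makes the weights `unitInterval`-valued everywhere and changes them only on a
  -- null set.
  let V : Ω → Field s := fun ω e => Set.projIcc (0 : ℝ) 1 zero_le_one (U e ω)
  have hV : MeasurePreserving V μ (weightLaw s) := measurePreserving_projIcc hU hindep hunif
  have hUV : ∀ᵐ ω ∂μ, (fun e => U e ω) = fun e => (V ω e : ℝ) := ae_eq_projIcc hU hunif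
  have hgood : ∀ᵐ ω ∂μ, Good (V ω) := hV.quasiMeasurePreserving.ae (ae_good hs)
  have hbounds : ∀ᵐ ω ∂μ, ∀ k, 1 / (s : ℝ) < forward (V ω) k ∧ forward (V ω) k < 1 :=
    hV.quasiMeasurePreserving.ae (ae_forward_bounds hs)
  have hcluster : ∀ᵐ ω ∂μ, ipc (fun e => U e ω) = cluster (V ω) :=
    hUV.mono fun ω hω => congrArg ipc hω
  refine ⟨fun ω => backbone (V ω), fun ω => forward (V ω), measurable_backbone.comp hV.measurable,
    measurable_forward.comp hV.measurable, ?_, ?_, ?_, ?_, ?_, ?_, ?_⟩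
  · filter_upwards [hgood, hcluster] with ω h1 h2 b
    rw [h2]
    exact h1.ray_mem_cluster_iff b
  · filter_upwards [hgood, hUV, hbounds] with ω h1 h2 h3 k
    refine ⟨?_, (h3 k).1, (h3 k).2⟩
    have h := h1.isGreatest_forward k
    have hset : {x : ℝ | ∃ j, k ≤ j ∧ x = U (rayEdge (backbone (V ω)) j) ω} =
        {x : ℝ | ∃ j, k ≤ j ∧ x = V ω (rayEdge (backbone (V ω)) j)} := by
      ext x
      exact exists_congr fun j => and_congr_right fun _ =>
        iff_of_eq (congrArg (x = ·) (congrFun h2 _))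
    rw [hset]
    exact h
  · rintro _ v rfl
    have h := weightLaw_rayVertex_inter hs v MeasurableSet.univ
    rw [Set.preimage_univ, Set.inter_univ, measure_univ, mul_one] at h
    have hm : MeasurableSet {w : Field s | rayVertex (backbone w) v.length = v} :=
      measurable_backbone (measurableSet_rayVertex v.length v)
    have h2 := hV.measure_preimage hm.nullMeasurableSet
    rw [measureReal_def]
    refine (congrArg ENNReal.toReal (h2.trans h)).trans ?_
    simp
  · rw [indepFun_iff_measure_inter_preimage_eq_mul]
    intro B S hB hS
    have hB' := measurable_backbone (s := s) hB
    have hS' := measurable_forward (s := s) hS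
    have h := indepFun_iff_measure_inter_preimage_eq_mul.1 (indepFun_backbone_forward hs) B S hB hS
    rw [← hV.measure_preimage (hB'.inter hS').nullMeasurableSet,
      ← hV.measure_preimage hB'.nullMeasurableSet, ← hV.measure_preimage hS'.nullMeasurableSet] at h
    exact h
  · filter_upwards [hgood, hcluster] with ω h1 h2
    rw [h2]
    exact h1.cluster_eq
  · intro F A hA
    -- For good weights the branches of the cluster are the sets `offBranch`, so the two events
    -- differ by a null set.
    refine Filter.EventuallyEq.trans (condExp_congr_ae ?_) (condExp_offBranch hs hV F hA)
    refine indicator_ae_eq_of_ae_eq_set ?_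
    filter_upwards [hgood, hcluster] with ω h1 h2
    refine propext (forall₂_congr fun x _ => forall_congr' fun hx => ?_)
    rw [h2, h1.branch_cluster_eq hx]
  · filter_upwards [hbounds] with ω h k i
    exact ⟨dual_lt hs (h k).1 i, finiteBranchLaw_eq_branchLaw (h k).2 i⟩
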